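/- Fix a number $n\ge 0$ of qubits. A gate is a unitary $2^n\times 2^n$ complex matrix, with rows and columns indexed by $\mathbb{F}_2^n$. Let $\mathcal{C}_1$ be the Pauli group, i.e. the set of gates $cP_1\otimes\cdots\otimes P_n$ with $c\in\{\pm1,\pm i\}$ and $P_j\in\{I_2,X,Y,Z\}$, and for $k\ge 2$ let $\mathcal{C}_k$ be the set of unitaries $U$ with $UPU^\dagger\in\mathcal{C}_{k-1}$ for all $P\in\mathcal{C}_1$. A gate is Clifford if it lies in the normalizer of the Pauli group in the unitary group; it is semi-Clifford if it equals $\phi_1 d\phi_2$ for some Clifford gates $\phi_1,\phi_2$ and some diagonal gate $d$; it is a permutation gate if it is a permutation matrix. A Clifford permutation is a gate that is both Clifford and a permutation gate. A multi-controlled NOT gate has a target qubit $t$ and a (possibly empty) set $S\not\ni t$ of control qubits, and maps $|a\rangle$ to $|a'\rangle$, where $a'_t=a_t+\prod_{s\in S}a_s$ and $a'_j=a_j$ for $j\ne t$. A Toffoli gate is a multi-controlled NOT gate with exactly two controls. A finite (possibly empty) product of multi-controlled NOT gates is mismatch-free if no qubit is the target of one of its gates and a control of another (equivalently, its gates commute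 pairwise). Let $\pi$ be a permutation gate on $n$ qubits. (1) For every integer $k\ge 1$: $\pi$ is semi-Clifford and $\pi\in\mathcal{C}_{k+1}$ if and only if there exist Clifford permutations $\phi_1,\phi_2$ and a mismatch-free product $\mu$ of multi-controlled NOT gates, each having at most $k$ controls, such that $\pi=\phi_1\mu\phi_2$. (2) $\pi$ is semi-Clifford and $\pi\in\mathcal{C}_3$ if and only if there exist Clifford permutations $\phi_1,\phi_2$ and a mismatch-free product $\mu$ of Toffoli gates such that $\pi=\phi_1\mu\phi_2$. (3) If $n\ge 1$ and $\pi$ is semi-Clifford, then $\pi\in\mathcal{C}_n$. -/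

import Mathlib

noncomputable section

namespace QGate

/-- Labels `a ∈ 𝔽₂ⁿ` of the computational basis states `|a⟩` of `n` qubits. -/
abbrev Bits (n : ℕ) : Type := Fin n → ZMod 2

/-- The group of `n`-qubit gates: unitary `2ⁿ × 2ⁿ` complex matrices, with rows and columns
indexed by `𝔽₂ⁿ`. -/
abbrev Gate (n : ℕ) : Type := Matrix.unitaryGroup (Bits n) ℂ

/-! ### Pauli and Clifford gates, and the Clifford hierarchy -/

/-- The single-qubit gate `X`, with rows `(0, 1), (1, 0)`. -/
def pauliX : Matrix (ZMod 2) (ZMod 2) ℂ :=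
  Matrix.of fun a b => if a = b then 0 else 1

/-- The single-qubit gate `Y`, with rows `(0, -i), (i, 0)`. -/
def pauliY : Matrix (ZMod 2) (ZMod 2) ℂ :=
  Matrix.of fun a b => if a = b then 0 else if a = 0 then -Complex.I else Complex.I

/-- The single-qubit gate `Z`, with rows `(1, 0), (0, -1)`. -/
def pauliZ : Matrix (ZMod 2) (ZMod 2) ℂ :=
  Matrix.of fun a b => if a = b then (if a = 0 then 1 else -1) else 0

/-- The tensor product `P₁ ⊗ ⋯ ⊗ Pₙ` of single-qubit matrices. -/
def tensor {n : ℕ} (P : Fin n → Matrix (ZMod 2) (ZMod 2) ℂ) : Matrix (Bits n) (Bits n) ℂ :=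
  Matrix.of fun a b => ∏ i, P i (a i) (b i)

/-- The `n`-qubit Pauli group: the gates `c P₁ ⊗ ⋯ ⊗ Pₙ` with `c ∈ {±1, ±i}` and
`Pⱼ ∈ {I, X, Y, Z}`. -/
def pauliGroup (n : ℕ) : Set (Gate n) :=
  {U | ∃ (c : ℂ) (P : Fin n → Matrix (ZMod 2) (ZMod 2) ℂ),
    (c = 1 ∨ c = -1 ∨ c = Complex.I ∨ c = -Complex.I) ∧
    (∀ i, P i = 1 ∨ P i = pauliX ∨ P i = pauliY ∨ P i = pauliZ) ∧
    (U : Matrix (Bits n) (Bits n) ℂ) = c • tensor P}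

/-- Clifford gates: the elements of the normalizer of the Pauli group in the unitary group. -/
def IsClifford {n : ℕ} (U : Gate n) : Prop :=
  ∀ P : Gate n, P ∈ pauliGroup n ↔ U * P * star U ∈ pauliGroup n

/-- The `k`-th level of the Clifford hierarchy on `n` qubits, for `k ≥ 1`: level `1` is the Pauli
group, and a unitary `U` is in level `k + 1` iff `U P U†` is in level `k` for every Pauli gate `P`.
(The hierarchy starts at level `1`; level `0` is empty by convention.) -/
def cliffordLevel (n : ℕ) : ℕ → Set (Gate n)
  | 0 => ∅
  | 1 => pauliGroup n
  | k + 2 => {U | ∀ P ∈ pauliGroup n, U * P * star U ∈ cliffordLevel n (k + 1)}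

/-- Diagonal gates. -/
def IsDiagonal {n : ℕ} (U : Gate n) : Prop :=
  (U : Matrix (Bits n) (Bits n) ℂ).IsDiag

/-- A gate is semi-Clifford if it is `φ₁ d φ₂` with `φ₁, φ₂` Clifford and `d` diagonal. -/
def IsSemiClifford {n : ℕ} (U : Gate n) : Prop :=
  ∃ φ₁ d φ₂ : Gate n, IsClifford φ₁ ∧ IsDiagonal d ∧ IsClifford φ₂ ∧ U = φ₁ * d * φ₂

/-! ### Permutation gates -/

/-- The matrix of `|b⟩ ↦ |σ b⟩`. -/
def permMat {n : ℕ} (σ : Equiv.Perm (Bits n)) : Matrix (Bits n) (Bits n) ℂ :=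
  Matrix.of fun a b => if a = σ b then 1 else 0

theorem permMat_mul {n : ℕ} (σ τ : Equiv.Perm (Bits n)) :
    permMat σ * permMat τ = permMat (σ * τ) := by
  ext a b
  simp only [permMat, Matrix.mul_apply, Matrix.of_apply, mul_ite, mul_one, mul_zero]
  rw [Finset.sum_eq_single (τ b)]
  · by_cases h : a = σ (τ b) <;> simp [h]
  · intro c _ hc
    simp [hc]
  · simp

theorem star_permMat {n : ℕ} (σ : Equiv.Perm (Bits n)) :
    star (permMat σ) = permMat σ⁻¹ := by
  ext a b
  simp only [permMat, Matrix.star_apply, Matrix.of_apply, Equiv.Perm.eq_inv_iff_eq, eq_comm]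
  split_ifs <;> simp

theorem permMat_one {n : ℕ} : permMat (1 : Equiv.Perm (Bits n)) = 1 := by
  ext a b
  by_cases h : a = b <;> simp [permMat, Matrix.one_apply, h]

/-- The permutation gate `|b⟩ ↦ |σ b⟩`. -/
def permGate {n : ℕ} (σ : Equiv.Perm (Bits n)) : Gate n :=
  ⟨permMat σ, by
    rw [Matrix.mem_unitaryGroup_iff, star_permMat, permMat_mul, mul_inv_cancel, permMat_one]⟩

/-- Permutation gates: gates whose matrix is a permutation matrix. -/
def IsPermutation {n : ℕ} (U : Gate n) : Prop :=
  ∃ σ : Equiv.Perm (Bits n), U = permGate σ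

theorem permGate_mul {n : ℕ} (σ τ : Equiv.Perm (Bits n)) :
    permGate σ * permGate τ = permGate (σ * τ) :=
  Subtype.ext (permMat_mul σ τ)

theorem permGate_injective {n : ℕ} : Function.Injective (permGate (n := n)) := by
  intro σ τ h
  ext1 b
  have h1 : permMat σ (σ b) b = permMat τ (σ b) b := by
    have h2 : permMat σ = permMat τ := congrArg Subtype.val h
    rw [h2]
  by_contra hne
  simp [permMat, hne] at h1

/-! ### Multi-controlled NOT gates -/

/-- A multi-controlled NOT gate on `n` qubits: a target qubit and a set of control qubits (possibly
empty) that does not contain the target. -/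
structure MCX (n : ℕ) where
  target : Fin n
  controls : Finset (Fin n)
  target_notMem : target ∉ controls

namespace MCX

variable {n : ℕ}

/-- The action on basis labels: the product of the control bits is added to the target bit. -/
def act (g : MCX n) (a : Bits n) : Bits n :=
  Function.update a g.target (a g.target + ∏ c ∈ g.controls, a c)

theorem prod_update (S : Finset (Fin n)) (t : Fin n) (ht : t ∉ S) (a : Bits n) (x : ZMod 2) :
    ∏ c ∈ S, Function.update a t x c = ∏ c ∈ S, a c := by
  refine Finset.prod_congr rfl fun c hc => ?_
  rw [Function.update_of_ne]
  rintro rfl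
  exact ht hc

theorem act_involutive (g : MCX n) : Function.Involutive g.act := by
  intro a
  simp only [act, prod_update _ _ g.target_notMem, Function.update_self, Function.update_idem,
    add_assoc, CharTwo.add_self_eq_zero, add_zero, Function.update_eq_self]

/-- The gate `|a⟩ ↦ |g a⟩` of a multi-controlled NOT. -/
def gate (g : MCX n) : Gate n := permGate g.act_involutive.toPerm

/-- A mismatch-free circuit: no qubit is the target of one gate and a control of another. -/
def MismatchFree (L : List (MCX n)) : Prop :=
  ∀ g ∈ L, ∀ h ∈ L, g.target ∉ h.controls

/-- The product of the gates in a list (first factor on the left). -/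
def circuit (L : List (MCX n)) : Gate n := (L.map gate).prod

theorem commute_gate_iff (g h : MCX n) :
    Commute g.gate h.gate ↔ ∀ a, g.act (h.act a) = h.act (g.act a) := by
  unfold gate Commute SemiconjBy
  rw [permGate_mul, permGate_mul, permGate_injective.eq_iff, Equiv.ext_iff]
  rfl

theorem no_mismatch_of_commute {g h : MCX n} (hc : Commute g.gate h.gate) :
    g.target ∉ h.controls := by
  intro hm
  have hne : h.target ≠ g.target := fun e => h.target_notMem (e ▸ hm)
  have h0 := congrFun ((commute_gate_iff g h).1 hc (fun _ => 1)) h.target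
  have hz : ∏ c ∈ h.controls, g.act (fun _ => 1) c = 0 := by
    refine Finset.prod_eq_zero hm ?_
    simp only [act, Function.update_self, Finset.prod_const_one]
    decide
  have e1 : g.act (h.act fun _ => 1) h.target = 0 := by
    rw [act, Function.update_of_ne hne]
    simp only [act, Function.update_self, Finset.prod_const_one]
    decide
  have e2 : h.act (g.act fun _ => 1) h.target = 1 := by
    rw [act, Function.update_self, hz, act, Function.update_of_ne hne]
    decide
  rw [e1, e2] at h0
  exact zero_ne_one h0

/-- A circuit is mismatch-free iff its gates commute pairwise, so the two usual definitions of
"mismatch-free" agree. -/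
theorem mismatchFree_iff_commute (L : List (MCX n)) :
    MismatchFree L ↔ ∀ g ∈ L, ∀ h ∈ L, Commute g.gate h.gate := by
  refine ⟨fun H g hg h hh => ?_, fun H g hg h hh => no_mismatch_of_commute (H g hg h hh)⟩
  rw [commute_gate_iff]
  intro a
  have h1 := H g hg h hh
  have h2 := H h hh g hg
  simp only [act, prod_update _ _ h1, prod_update _ _ h2]
  by_cases e : g.target = h.target
  · rw [e]
    simp only [Function.update_self, Function.update_idem]
    congr 1
    ring
  · rw [Function.update_of_ne e, Function.update_of_ne (Ne.symm e), Function.update_comm e]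

end MCX

end QGate

end

/-!
Write `V = 𝔽₂ⁿ`. Pauli gates are, up to a phase, the gates `X^a Z^ℓ : |v⟩ ↦ (-1)^{ℓ v} |v + a⟩` with
`a ∈ V` and a linear form `ℓ` on `V` (`mem_pauliGroup_iff`).

*Normal form.* Let `σ` be a permutation of `V` whose gate is semi-Clifford, `π = φ₁ d φ₂`.
Conjugation by `π` maps `X^a Z^ℓ` to a Pauli gate iff it does so for `X^a` and for `Z^ℓ` separately.
Let `B` be the space of forms `ℓ` for which `Z^ℓ` is mapped to a Pauli gate (`affineForms`) and `W`
the subspace of `V` annihilated by `B`. The commuting Pauli gates `φ₂⁻¹ Z^m φ₂` are mapped to Pauli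
gates, so `X^w` with `w ∈ W` commutes with all of them; then `φ₂ X^w φ₂⁻¹` is diagonal, and `π` maps
`X^w` to a Pauli gate as well (`IsSemiClifford.exists_map_add_eq`). Hence `σ` is additive in the
direction of `W` and affine modulo `W`. In linear coordinates in which `W` is a coordinate subspace,
`σ` is therefore, up to an affine change of coordinates on the target, a shear `v ↦ v + f v`, where
`f` moves only the coordinates in a set `T` and depends only on the others
(`IsSemiClifford.exists_shear`). Affine permutations are Clifford.

*Levels.* Polynomial degree over `𝔽₂` is measured by finite differences (`DegreeLT`), which are what
commutators with `X^a` produce. The diagonal gate with sign `(-1)^g` lies in level `k` only if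
`deg g ≤ k`, so the inverse of a permutation in level `k + 1` has degree at most `k`
(`degreeLT_of_permGate_mem`). Conversely the shear of `f` with `deg f ≤ k` lies in level `k + 1`,
by an induction over signed shears (`mono_mem_cliffordLevel`).

*Circuits.* Over `𝔽₂`, a function of degree at most `k` is a sum of squarefree monomials of degree at
most `k`, so the shears with `deg f ≤ k` are exactly the mismatch-free circuits with at most `k`
controls per gate (`MCX.exists_mismatchFree_of_degreeLT`). These are semi-Clifford, because Hadamard
gates on the target qubits diagonalize them (`permGate_mul_hadamardGate`). For level three, the gates
with at most one control are Clifford and are split off. For the last claim, a moved coordinate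
depends on at most `n - 1` others, so that `deg f ≤ n - 1`.
-/

noncomputable section

namespace QGate

/-! ### Polynomial degree through finite differences -/

/-- `DegreeLT k f` says that `f` is a polynomial map of degree less than `k`, in the sense that all
its `k`-fold finite differences vanish. In particular `DegreeLT 1` means constant and
`DegreeLT 2` means affine. -/
def DegreeLT {M G : Type*} [AddCommGroup M] [AddCommGroup G] : ℕ → (M → G) → Prop
  | 0, f => f = 0
  | k + 1, f => ∀ h, DegreeLT k (fwdDiff h f)

namespace DegreeLT

variable {M M' G H : Type*} [AddCommGroup M] [AddCommGroup M'] [AddCommGroup G] [AddCommGroup H]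

theorem zero (k : ℕ) : DegreeLT k (0 : M → G) := by
  induction k with
  | zero => rfl
  | succ k ih =>
    intro h
    convert ih using 1
    ext v
    simp [fwdDiff]

theorem add {k : ℕ} {f g : M → G} (hf : DegreeLT k f) (hg : DegreeLT k g) :
    DegreeLT k (f + g) := by
  induction k generalizing f g with
  | zero =>
    rw [DegreeLT] at *
    rw [hf, hg, add_zero]
  | succ k ih =>
    intro h
    rw [fwdDiff_add]
    exact ih (hf h) (hg h)

theorem succ {k : ℕ} {f : M → G} (hf : DegreeLT k f) : DegreeLT (k + 1) f := by
  induction k generalizing f with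
  | zero =>
    rw [DegreeLT] at hf
    rw [hf]
    exact zero 1
  | succ k ih => exact fun h => ih (hf h)

theorem mono {k l : ℕ} (hkl : k ≤ l) {f : M → G} (hf : DegreeLT k f) : DegreeLT l f := by
  induction hkl with
  | refl => exact hf
  | step _ ih => exact ih.succ

theorem const (c : G) : DegreeLT 1 (fun _ : M => c) := by
  intro h
  ext v
  simp [fwdDiff]

/-- Postcomposition with a homomorphism does not raise the degree. -/
theorem map {k : ℕ} {f : M → G} (hf : DegreeLT k f) (ψ : G →+ H) :
    DegreeLT k (fun v => ψ (f v)) := by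
  induction k generalizing f with
  | zero =>
    rw [DegreeLT] at *
    ext v
    simp [hf]
  | succ k ih =>
    intro h
    convert ih (hf h) using 1
    ext v
    simp [fwdDiff]

/-- Precomposition with a homomorphism does not raise the degree. -/
theorem comp {k : ℕ} {f : M → G} (hf : DegreeLT k f) (φ : M' →+ M) :
    DegreeLT k (fun v => f (φ v)) := by
  induction k generalizing f with
  | zero =>
    rw [DegreeLT] at *
    ext v
    simp [hf]
  | succ k ih =>
    intro h
    convert ih (hf (φ h)) using 1
    ext v
    simp [fwdDiff]

theorem translate {k : ℕ} {f : M → G} (hf : DegreeLT k f) (a : M) :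
    DegreeLT k (fun v => f (v + a)) := by
  induction k generalizing f with
  | zero =>
    rw [DegreeLT] at *
    ext v
    simp [hf]
  | succ k ih =>
    intro h
    convert ih (hf h) using 1
    ext v
    simp [fwdDiff, add_right_comm]

/-- Multiplication by a linear form raises the degree by at most one. -/
theorem linear_mul {R : Type*} [CommRing R] {k : ℕ} {f : M → R} (hf : DegreeLT k f)
    (ψ : M →+ R) : DegreeLT (k + 1) (fun v => ψ v * f v) := by
  induction k generalizing f with
  | zero =>
    rw [DegreeLT] at hf
    subst hf
    convert zero 1 using 1
    ext v
    simp
  | succ k ih =>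
    intro h
    convert (ih (hf h)).add ((hf.translate h).map (AddMonoidHom.mulLeft (ψ h))) using 1
    ext v
    simp only [fwdDiff, map_add, Pi.add_apply, AddMonoidHom.coe_mulLeft]
    ring

theorem monomial {n : ℕ} (S : Finset (Fin n)) :
    DegreeLT (S.card + 1) (fun v : Bits n => ∏ s ∈ S, v s) := by
  induction S using Finset.induction_on with
  | empty => simpa using const (M := Bits n) (1 : ZMod 2)
  | insert s S hs ih =>
    rw [Finset.card_insert_of_notMem hs]
    simp only [Finset.prod_insert hs]
    exact ih.linear_mul (Pi.evalAddMonoidHom (fun _ : Fin n => ZMod 2) s)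

/-- A map of degree at most one is additive up to its constant term. -/
theorem map_add_of_two {f : M → G} (hf : DegreeLT 2 f) (v w : M) :
    f (v + w) - f 0 = (f v - f 0) + (f w - f 0) := by
  have h := congrFun (hf w v) 0
  simp only [fwdDiff, zero_add, Pi.zero_apply, add_comm v w] at h
  have h' : f (v + w) - f v - (f w - f 0) = 0 := by rw [add_comm v w]; exact h
  rw [sub_eq_zero] at h'
  rw [← h']
  abel

theorem of_additive {f : M → G} (hf : ∀ v w, f (v + w) - f 0 = (f v - f 0) + (f w - f 0)) :
    DegreeLT 2 f := by
  have key : ∀ v w, f (v + w) - f v = f w - f 0 := by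
    intro v w
    have := hf v w
    rw [sub_eq_iff_eq_add] at this
    rw [this]
    abel
  intro h h'
  ext v
  simp [fwdDiff, key]

end DegreeLT

variable {n : ℕ}

/-- The endomorphism of `𝔽₂ⁿ` that sets the coordinate `s` to zero. -/
def setZero (s : Fin n) : Bits n →+ Bits n where
  toFun v := Function.update v s 0
  map_zero' := by simp
  map_add' v w := by
    ext i
    by_cases h : i = s
    · subst h; simp
    · simp [h]

theorem setZero_apply (s : Fin n) (v : Bits n) : setZero s v = Function.update v s 0 := rfl

/-- A function `g` over `𝔽₂` is `g|_{s = 0} + v_s · (Δ_s g)|_{s = 0}`. -/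
theorem eq_setZero_add (s : Fin n) (g : Bits n → ZMod 2) (v : Bits n) :
    g v = g (setZero s v) + v s * fwdDiff (Pi.single s 1) g (setZero s v) := by
  have hv : v s = 0 ∨ v s = 1 := by
    generalize v s = x
    revert x
    decide
  rcases hv with e | e
  · have : setZero s v = v := by rw [setZero_apply, ← e, Function.update_eq_self]
    rw [e, zero_mul, add_zero, this]
  · have : setZero s v + Pi.single s 1 = v := by
      ext i
      by_cases h : i = s
      · subst h; simp [setZero_apply, e]
      · simp [setZero_apply, h]
    rw [e, one_mul, fwdDiff, this]
    ring

section Elimination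

variable {s : Fin n} {C : Finset (Fin n)} {g : Bits n → ZMod 2}

theorem setZero_congr {v w : Bits n} (h : ∀ i ∈ C, v i = w i) :
    ∀ i ∈ insert s C, setZero s v i = setZero s w i := by
  intro i hi
  rw [setZero_apply, setZero_apply]
  by_cases e : i = s
  · subst e; simp
  · simp [e, h i (Finset.mem_of_mem_insert_of_ne hi e)]

theorem dependsOn_comp_setZero (hg : DependsOn g (insert s C : Finset (Fin n))) :
    DependsOn (fun v => g (setZero s v)) (C : Set (Fin n)) :=
  fun _ _ h => hg (setZero_congr h)

theorem dependsOn_fwdDiff_comp_setZero (hg : DependsOn g (insert s C : Finset (Fin n)))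
    (a : Bits n) : DependsOn (fun v => fwdDiff a g (setZero s v)) (C : Set (Fin n)) := by
  intro v w h
  simp only [fwdDiff]
  rw [hg (setZero_congr h), hg (x := setZero s v + a) (y := setZero s w + a) fun i hi => by
    rw [Pi.add_apply, Pi.add_apply, setZero_congr h i hi]]

end Elimination

namespace DegreeLT

/-- A function of the coordinates in `C` has degree at most `|C|`. -/
theorem of_dependsOn (C : Finset (Fin n)) {g : Bits n → ZMod 2}
    (hC : DependsOn g (C : Set (Fin n))) : DegreeLT (C.card + 1) g := by
  induction C using Finset.induction_on generalizing g with
  | empty =>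
    rw [Finset.card_empty, zero_add]
    convert const (M := Bits n) (g 0) using 1
    ext v
    exact hC (by simp)
  | insert s C hs ih =>
    rw [Finset.card_insert_of_notMem hs]
    rw [funext (eq_setZero_add s g)]
    exact (ih (dependsOn_comp_setZero hC)).succ.add
      ((ih (dependsOn_fwdDiff_comp_setZero hC _)).linear_mul
        (Pi.evalAddMonoidHom (fun _ : Fin n => ZMod 2) s))

/-- Every function of degree less than `k` over `𝔽₂` that depends only on the coordinates in `C` is
a sum of squarefree monomials in those coordinates with fewer than `k` factors. -/
theorem exists_monomials (C : Finset (Fin n)) {k : ℕ} {g : Bits n → ZMod 2}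
    (hg : DegreeLT k g) (hC : DependsOn g (C : Set (Fin n))) :
    ∃ L : List (Finset (Fin n)), (∀ S ∈ L, S ⊆ C ∧ S.card < k) ∧
      ∀ v, g v = (L.map fun S => ∏ s ∈ S, v s).sum := by
  induction C using Finset.induction_on generalizing k g with
  | empty =>
    cases k with
    | zero =>
      rw [DegreeLT] at hg
      exact ⟨[], by simp, by simp [hg]⟩
    | succ k =>
      have h0 : ∀ v, g v = g 0 := fun v => hC (by simp)
      by_cases h : g 0 = 0
      · exact ⟨[], by simp, fun v => by simp [h0 v, h]⟩
      · have h1 : g 0 = 1 := by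
          generalize g 0 = x at h
          revert x
          decide
        exact ⟨[∅], by simp, fun v => by simp [h0 v, h1]⟩
  | insert s C hs ih =>
    cases k with
    | zero =>
      rw [DegreeLT] at hg
      exact ⟨[], by simp, by simp [hg]⟩
    | succ k =>
      obtain ⟨L₀, hL₀, h₀⟩ := ih (hg.comp (setZero s)) (dependsOn_comp_setZero hC)
      obtain ⟨L₁, hL₁, h₁⟩ := ih ((hg (Pi.single s 1)).comp (setZero s))
        (dependsOn_fwdDiff_comp_setZero hC _)
      refine ⟨L₀ ++ L₁.map (insert s), ?_, ?_⟩
      · intro S hS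
        rcases List.mem_append.1 hS with h | h
        · exact ⟨(hL₀ S h).1.trans (Finset.subset_insert _ _), (hL₀ S h).2⟩
        · obtain ⟨S', hS', rfl⟩ := List.mem_map.1 h
          refine ⟨Finset.insert_subset_insert _ (hL₁ S' hS').1, ?_⟩
          exact (Finset.card_insert_le _ _).trans_lt (Nat.succ_lt_succ (hL₁ S' hS').2)
      · intro v
        have e₁ : (L₁.map fun S => ∏ i ∈ insert s S, v i).sum
            = v s * (L₁.map fun S => ∏ i ∈ S, v i).sum := by
          rw [← List.sum_map_mul_left]
          refine congrArg List.sum (List.map_congr_left fun S hS => ?_)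
          exact Finset.prod_insert fun h => hs ((hL₁ S hS).1 h)
        rw [List.map_append, List.sum_append, List.map_map, Function.comp_def, e₁, ← h₀, ← h₁]
        exact eq_setZero_add s g v

end DegreeLT

/-! ### Signed permutation gates and phases -/

/-- The sign `(-1)ˣ` of a bit `x`. -/
def sgn (x : ZMod 2) : ℂ := if x = 0 then 1 else -1

theorem zmod_two_cases (x : ZMod 2) : x = 0 ∨ x = 1 := by
  revert x
  decide

@[simp] theorem sgn_zero : sgn 0 = 1 := by simp [sgn]

@[simp] theorem sgn_one : sgn 1 = -1 := by simp [sgn]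

theorem sgn_add (x y : ZMod 2) : sgn (x + y) = sgn x * sgn y := by
  rcases zmod_two_cases x with rfl | rfl <;> rcases zmod_two_cases y with rfl | rfl <;>
    simp [CharTwo.add_self_eq_zero]

theorem sgn_mul_self (x : ZMod 2) : sgn x * sgn x = 1 := by
  rw [← sgn_add, CharTwo.add_self_eq_zero, sgn_zero]

theorem sgn_injective : Function.Injective sgn := by
  intro x y h
  have h1 : (1 : ℂ) ≠ -1 := by norm_num
  rcases zmod_two_cases x with rfl | rfl <;> rcases zmod_two_cases y with rfl | rfl
  · rfl
  · rw [sgn_zero, sgn_one] at h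
    exact absurd h h1
  · rw [sgn_zero, sgn_one] at h
    exact absurd h.symm h1
  · rfl

theorem sgn_sum {ι : Type*} (s : Finset ι) (f : ι → ZMod 2) :
    sgn (∑ i ∈ s, f i) = ∏ i ∈ s, sgn (f i) := by
  classical
  induction s using Finset.induction_on with
  | empty => simp
  | insert i s hi ih => rw [Finset.sum_insert hi, Finset.prod_insert hi, sgn_add, ih]

theorem star_sgn (x : ZMod 2) : star (sgn x) = sgn x := by
  rcases zmod_two_cases x with rfl | rfl <;> simp

/-- The matrix of `|b⟩ ↦ (-1)^{g b} |σ b⟩`. -/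
def monoMat (σ : Equiv.Perm (Bits n)) (g : Bits n → ZMod 2) : Matrix (Bits n) (Bits n) ℂ :=
  Matrix.of fun a b => if a = σ b then sgn (g b) else 0

theorem monoMat_mul (σ τ : Equiv.Perm (Bits n)) (g h : Bits n → ZMod 2) :
    monoMat σ g * monoMat τ h = monoMat (σ * τ) (fun v => g (τ v) + h v) := by
  ext a b
  simp only [monoMat, Matrix.mul_apply, Matrix.of_apply, mul_ite, mul_zero]
  rw [Finset.sum_eq_single (τ b)]
  · by_cases h : a = σ (τ b) <;> simp [h, sgn_add]
  · intro c _ hc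
    simp [hc]
  · simp

theorem star_monoMat (σ : Equiv.Perm (Bits n)) (g : Bits n → ZMod 2) :
    star (monoMat σ g) = monoMat σ⁻¹ (fun v => g (σ⁻¹ v)) := by
  ext a b
  simp only [monoMat, Matrix.star_apply, Matrix.of_apply, Equiv.Perm.eq_inv_iff_eq]
  by_cases h : b = σ a
  · subst h
    simp [star_sgn]
  · simp [h, Ne.symm h]

theorem monoMat_one : monoMat (1 : Equiv.Perm (Bits n)) 0 = 1 := by
  ext a b
  by_cases h : a = b <;> simp [monoMat, Matrix.one_apply, h]

/-- The signed permutation gate `|b⟩ ↦ (-1)^{g b} |σ b⟩`. -/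
def mono (σ : Equiv.Perm (Bits n)) (g : Bits n → ZMod 2) : Gate n :=
  ⟨monoMat σ g, by
    rw [Matrix.mem_unitaryGroup_iff, star_monoMat, monoMat_mul, mul_inv_cancel, ← monoMat_one]
    congr 1
    ext v
    exact CharTwo.add_self_eq_zero _⟩

theorem mono_mul (σ τ : Equiv.Perm (Bits n)) (g h : Bits n → ZMod 2) :
    mono σ g * mono τ h = mono (σ * τ) (fun v => g (τ v) + h v) :=
  Subtype.ext (monoMat_mul σ τ g h)

theorem permGate_eq_mono (σ : Equiv.Perm (Bits n)) : permGate σ = mono σ 0 := by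
  apply Subtype.ext
  ext a b
  simp [permGate, permMat, mono, monoMat]

theorem permGate_one : permGate (1 : Equiv.Perm (Bits n)) = 1 :=
  Subtype.ext permMat_one

/-- The scalar gate of a fourth root of unity. -/
def phase : rootsOfUnity 4 ℂ →* Gate n where
  toFun c := ⟨((c : ℂˣ) : ℂ) • 1, by
    have h : star ((c : ℂˣ) : ℂ) * ((c : ℂˣ) : ℂ) = 1 := by
      have h1 : ‖((c : ℂˣ) : ℂ)‖ = 1 :=
        Complex.norm_eq_one_of_mem_rootsOfUnity c.2
      rw [mul_comm, Complex.star_def, Complex.mul_conj, Complex.normSq_eq_norm_sq, h1]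
      norm_num
    rw [Matrix.mem_unitaryGroup_iff']
    rw [star_smul, star_one, smul_mul_smul_comm, h, one_smul, mul_one]⟩
  map_one' := Subtype.ext (by simp)
  map_mul' c d := Subtype.ext (by
    change ((((c * d : rootsOfUnity 4 ℂ) : ℂˣ) : ℂ) • (1 : Matrix (Bits n) (Bits n) ℂ)) = _
    simp [smul_smul, mul_comm])

theorem coe_phase_mul (c : rootsOfUnity 4 ℂ) (U : Gate n) :
    ((phase c * U : Gate n) : Matrix (Bits n) (Bits n) ℂ) = ((c : ℂˣ) : ℂ) • U.1 := by
  change (((c : ℂˣ) : ℂ) • (1 : Matrix (Bits n) (Bits n) ℂ)) * U.1 = _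
  rw [smul_mul_assoc, one_mul]

theorem phase_comm (c : rootsOfUnity 4 ℂ) (U : Gate n) : phase c * U = U * phase c := by
  apply Subtype.ext
  rw [coe_phase_mul]
  change _ = U.1 * (((c : ℂˣ) : ℂ) • (1 : Matrix (Bits n) (Bits n) ℂ))
  rw [mul_smul_comm, mul_one]

theorem phase_left_comm (c : rootsOfUnity 4 ℂ) (U V : Gate n) :
    U * (phase c * V) = phase c * (U * V) := by
  rw [← mul_assoc, ← phase_comm, mul_assoc]

theorem exists_root {c : ℂ} (hc : c ^ 4 = 1) : ∃ r : rootsOfUnity 4 ℂ, ((r : ℂˣ) : ℂ) = c :=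
  ⟨rootsOfUnity.mkOfPowEq c hc, rootsOfUnity.coe_mkOfPowEq hc⟩

theorem root_pow (r : rootsOfUnity 4 ℂ) : ((r : ℂˣ) : ℂ) ^ 4 = 1 := by
  have := (mem_rootsOfUnity' 4 (r : ℂˣ)).1 r.2
  exact this

theorem pow_four_eq_one_iff (c : ℂ) :
    c ^ 4 = 1 ↔ (c = 1 ∨ c = -1 ∨ c = Complex.I ∨ c = -Complex.I) := by
  constructor
  · intro h
    have h1 : (c - 1) * ((c + 1) * ((c - Complex.I) * (c + Complex.I))) = 0 := by
      linear_combination h + (1 - c ^ 2) * Complex.I_sq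
    rcases mul_eq_zero.1 h1 with h | h
    · exact Or.inl (sub_eq_zero.1 h)
    rcases mul_eq_zero.1 h with h | h
    · exact Or.inr (Or.inl (eq_neg_of_add_eq_zero_left h))
    rcases mul_eq_zero.1 h with h | h
    · exact Or.inr (Or.inr (Or.inl (sub_eq_zero.1 h)))
    · exact Or.inr (Or.inr (Or.inr (eq_neg_of_add_eq_zero_left h)))
  · rintro (rfl | rfl | rfl | rfl)
    · norm_num
    · norm_num
    · exact Complex.I_pow_four
    · rw [neg_pow, Complex.I_pow_four]
      norm_num

theorem exists_phase_sgn (e : ZMod 2) : ∃ r : rootsOfUnity 4 ℂ, ((r : ℂˣ) : ℂ) = sgn e :=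
  exists_root <| by
    have := sgn_mul_self e
    linear_combination (sgn e ^ 2 + 1) * this

/-- A constant added to the exponent of a signed permutation gate is a global phase. -/
theorem exists_phase_mono (e : ZMod 2) : ∃ r : rootsOfUnity 4 ℂ,
    ∀ (σ : Equiv.Perm (Bits n)) (g : Bits n → ZMod 2),
      mono σ (fun v => g v + e) = phase r * mono σ g := by
  obtain ⟨r, hr⟩ := exists_phase_sgn e
  refine ⟨r, fun σ g => ?_⟩
  apply Subtype.ext
  rw [coe_phase_mul, hr]
  ext a b
  simp [mono, monoMat, sgn_add, mul_comm]

/-- A signed permutation gate determines its permutation, and its exponent up to a constant. -/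
theorem phase_mono_inj {c d : rootsOfUnity 4 ℂ} {σ τ : Equiv.Perm (Bits n)}
    {g h : Bits n → ZMod 2} (H : phase c * mono σ g = phase d * mono τ h) :
    σ = τ ∧ ∀ v, g v = h v + (g 0 + h 0) := by
  have hm : ∀ a b, ((c : ℂˣ) : ℂ) * (if a = σ b then sgn (g b) else 0)
      = ((d : ℂˣ) : ℂ) * (if a = τ b then sgn (h b) else 0) := by
    intro a b
    have H' := congrArg (fun U : Gate n => U.1 a b) H
    rw [coe_phase_mul, coe_phase_mul] at H'
    exact H'
  have hs : ∀ x, sgn x ≠ 0 := fun x hx => by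
    have := sgn_mul_self x
    rw [hx] at this
    simp at this
  have hc : ((c : ℂˣ) : ℂ) ≠ 0 := Units.ne_zero _
  have hd : ((d : ℂˣ) : ℂ) ≠ 0 := Units.ne_zero _
  have hστ : σ = τ := by
    ext1 b
    by_contra hne
    have := hm (σ b) b
    rw [if_pos rfl, if_neg hne, mul_zero] at this
    exact mul_ne_zero hc (hs _) this
  subst hστ
  refine ⟨rfl, fun v => sgn_injective ?_⟩
  have hv := hm (σ v) v
  have h0 := hm (σ 0) 0
  rw [if_pos rfl, if_pos rfl] at hv h0
  rw [sgn_add, sgn_add]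
  -- both sides are multiplied by `c`, and `c = d (-1)^{h 0 + g 0}` is substituted
  apply mul_left_cancel₀ hc
  linear_combination hv + ((d : ℂˣ) : ℂ) * sgn (h v) * (-sgn_mul_self (h 0)) -
    sgn (h v) * sgn (h 0) * h0

/-! ### The Pauli group -/

/-- The gate `X^a Z^ℓ : |v⟩ ↦ (-1)^{ℓ v} |v + a⟩`, where the `Z`-part is encoded by a linear form
`ℓ` on the space of labels. -/
def pauliXZ (a : Bits n) (ℓ : Bits n →ₗ[ZMod 2] ZMod 2) : Gate n := mono (Equiv.addRight a) ℓ

theorem linearForm_apply (ℓ : Bits n →ₗ[ZMod 2] ZMod 2) (v : Bits n) :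
    ℓ v = ∑ i, ℓ (Pi.single i 1) * v i := by
  conv_lhs => rw [pi_eq_sum_univ' v, map_sum]
  refine Finset.sum_congr rfl fun i _ => ?_
  rw [map_smul, smul_eq_mul, mul_comm]

theorem exists_single_qubit_form {P : Matrix (ZMod 2) (ZMod 2) ℂ}
    (hP : P = 1 ∨ P = pauliX ∨ P = pauliY ∨ P = pauliZ) :
    ∃ (c : ℂ) (a b : ZMod 2), c ^ 4 = 1 ∧
      ∀ x y, P x y = c * (if x = y + a then sgn (b * y) else 0) := by
  rcases hP with rfl | rfl | rfl | rfl
  · refine ⟨1, 0, 0, by norm_num, fun x y => ?_⟩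
    simp [Matrix.one_apply]
  · refine ⟨1, 1, 0, by norm_num, fun x y => ?_⟩
    rcases zmod_two_cases x with rfl | rfl <;> rcases zmod_two_cases y with rfl | rfl <;>
      simp [pauliX, CharTwo.add_self_eq_zero]
  · refine ⟨Complex.I, 1, 1, Complex.I_pow_four, fun x y => ?_⟩
    rcases zmod_two_cases x with rfl | rfl <;> rcases zmod_two_cases y with rfl | rfl <;>
      simp [pauliY, CharTwo.add_self_eq_zero]
  · refine ⟨1, 0, 1, by norm_num, fun x y => ?_⟩
    rcases zmod_two_cases x with rfl | rfl <;> rcases zmod_two_cases y with rfl | rfl <;>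
      simp [pauliZ]

theorem exists_single_qubit_pauli (a b : ZMod 2) :
    ∃ (c : ℂ) (P : Matrix (ZMod 2) (ZMod 2) ℂ), c ^ 4 = 1 ∧
      (P = 1 ∨ P = pauliX ∨ P = pauliY ∨ P = pauliZ) ∧
      ∀ x y, (if x = y + a then sgn (b * y) else 0) = c * P x y := by
  rcases zmod_two_cases a with rfl | rfl <;> rcases zmod_two_cases b with rfl | rfl
  · refine ⟨1, 1, by norm_num, by simp, fun x y => ?_⟩
    simp [Matrix.one_apply]
  · refine ⟨1, pauliZ, by norm_num, by simp, fun x y => ?_⟩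
    rcases zmod_two_cases x with rfl | rfl <;> rcases zmod_two_cases y with rfl | rfl <;>
      simp [pauliZ]
  · refine ⟨1, pauliX, by norm_num, by simp, fun x y => ?_⟩
    rcases zmod_two_cases x with rfl | rfl <;> rcases zmod_two_cases y with rfl | rfl <;>
      simp [pauliX, CharTwo.add_self_eq_zero]
  · refine ⟨-Complex.I, pauliY, ?_, by simp, fun x y => ?_⟩
    · exact (pow_four_eq_one_iff _).2 (by simp)
    · rcases zmod_two_cases x with rfl | rfl <;> rcases zmod_two_cases y with rfl | rfl <;>
        simp [pauliY, CharTwo.add_self_eq_zero]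

theorem prod_single_qubit_form (a b v w : Bits n) :
    ∏ i, (if v i = w i + a i then sgn (b i * w i) else 0)
      = if v = w + a then sgn (∑ i, b i * w i) else 0 := by
  rw [Finset.prod_ite_zero, sgn_sum]
  simp [funext_iff]

theorem mem_pauliGroup_iff (U : Gate n) :
    U ∈ pauliGroup n ↔ ∃ (c : rootsOfUnity 4 ℂ) (a : Bits n) (ℓ : Bits n →ₗ[ZMod 2] ZMod 2),
      U = phase c * pauliXZ a ℓ := by
  constructor
  · rintro ⟨c, P, hc, hP, hU⟩
    choose d a b hd hform using fun i => exists_single_qubit_form (hP i)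
    obtain ⟨r, hr⟩ := exists_root (c := c * ∏ i, d i) <| by
      rw [mul_pow, (pow_four_eq_one_iff c).2 hc, ← Finset.prod_pow]
      simp [hd]
    refine ⟨r, a, Fintype.linearCombination (ZMod 2) b, Subtype.ext ?_⟩
    rw [coe_phase_mul, hU, hr]
    ext v w
    simp only [tensor, Matrix.smul_apply, Matrix.of_apply, hform, Finset.prod_mul_distrib,
      prod_single_qubit_form, smul_eq_mul, pauliXZ, mono, monoMat, Equiv.coe_addRight,
      Fintype.linearCombination_apply]
    rw [mul_assoc]
    simp only [mul_comm]
  · rintro ⟨c, a, ℓ, rfl⟩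
    choose d P hd hP hform using fun i => exists_single_qubit_pauli (a i) (ℓ (Pi.single i 1))
    refine ⟨((c : ℂˣ) : ℂ) * ∏ i, d i, P, ?_, hP, ?_⟩
    · rw [← pow_four_eq_one_iff, mul_pow, root_pow, ← Finset.prod_pow]
      simp [hd]
    · rw [coe_phase_mul]
      ext v w
      simp only [tensor, Matrix.smul_apply, Matrix.of_apply, smul_eq_mul, pauliXZ, mono, monoMat,
        Equiv.coe_addRight]
      have h := prod_single_qubit_form a (fun i => ℓ (Pi.single i 1)) v w
      simp only [hform, ← linearForm_apply] at h
      rw [mul_assoc, ← Finset.prod_mul_distrib, h]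
      congr 1

theorem phase_mul_pauliXZ_mem (c : rootsOfUnity 4 ℂ) (a : Bits n)
    (ℓ : Bits n →ₗ[ZMod 2] ZMod 2) : phase c * pauliXZ a ℓ ∈ pauliGroup n :=
  (mem_pauliGroup_iff _).2 ⟨c, a, ℓ, rfl⟩

theorem pauliXZ_mem (a : Bits n) (ℓ : Bits n →ₗ[ZMod 2] ZMod 2) :
    pauliXZ a ℓ ∈ pauliGroup n := by
  simpa using phase_mul_pauliXZ_mem 1 a ℓ

theorem pauliXZ_mul (a b : Bits n) (ℓ m : Bits n →ₗ[ZMod 2] ZMod 2) :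
    ∃ r : rootsOfUnity 4 ℂ, pauliXZ a ℓ * pauliXZ b m = phase r * pauliXZ (b + a) (ℓ + m) := by
  obtain ⟨r, hr⟩ := exists_phase_mono (n := n) (ℓ b)
  refine ⟨r, ?_⟩
  rw [pauliXZ, pauliXZ, mono_mul, pauliXZ, ← hr]
  congr 1
  · ext1 v
    simp [add_assoc]
  · ext v
    simp only [Equiv.coe_addRight, map_add, LinearMap.add_apply]
    ring

theorem pauliXZ_zero : pauliXZ (0 : Bits n) 0 = 1 := by
  rw [← permGate_one, permGate_eq_mono, pauliXZ]
  congr 1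
  ext1 v
  simp

/-- The Pauli group as a subgroup of the unitary group. -/
def pauliSubgroup (n : ℕ) : Subgroup (Gate n) where
  carrier := pauliGroup n
  one_mem' := by
    rw [← pauliXZ_zero]
    exact pauliXZ_mem 0 0
  mul_mem' := by
    intro U V hU hV
    obtain ⟨c, a, ℓ, rfl⟩ := (mem_pauliGroup_iff U).1 hU
    obtain ⟨d, b, m, rfl⟩ := (mem_pauliGroup_iff V).1 hV
    obtain ⟨r, hr⟩ := pauliXZ_mul a b ℓ m
    refine (mem_pauliGroup_iff _).2 ⟨c * (d * r), b + a, ℓ + m, ?_⟩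
    rw [map_mul, map_mul, mul_assoc, phase_left_comm, hr, mul_assoc, mul_assoc]
  inv_mem' := by
    intro U hU
    obtain ⟨c, a, ℓ, rfl⟩ := (mem_pauliGroup_iff U).1 hU
    obtain ⟨r, hr⟩ := pauliXZ_mul a a ℓ ℓ
    have h2 : ℓ + ℓ = 0 := by
      ext v
      exact CharTwo.add_self_eq_zero _
    have h3 : a + a = 0 := by
      ext i
      exact CharTwo.add_self_eq_zero _
    rw [h2, h3, pauliXZ_zero, mul_one] at hr
    refine (mem_pauliGroup_iff _).2 ⟨c⁻¹ * r⁻¹, a, ℓ, inv_eq_of_mul_eq_one_right ?_⟩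
    rw [mul_assoc, phase_left_comm, hr, ← map_mul, ← map_mul, ← map_one phase]
    congr 1
    group

/-! ### Clifford gates and the Clifford hierarchy -/

namespace IsClifford

theorem conj_mem {φ : Gate n} (hφ : IsClifford φ) {P : Gate n} (hP : P ∈ pauliGroup n) :
    φ * P * φ⁻¹ ∈ pauliGroup n := (hφ P).1 hP

protected theorem inv {φ : Gate n} (hφ : IsClifford φ) : IsClifford φ⁻¹ := by
  intro P
  have : φ * (φ⁻¹ * P * star φ⁻¹) * star φ = P := by
    change φ * (φ⁻¹ * P * φ⁻¹⁻¹) * φ⁻¹ = P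
    group
  have h := hφ (φ⁻¹ * P * star φ⁻¹)
  rw [this] at h
  exact h.symm

theorem conj_mem' {φ : Gate n} (hφ : IsClifford φ) {P : Gate n} (hP : P ∈ pauliGroup n) :
    φ⁻¹ * P * φ ∈ pauliGroup n := by
  simpa using hφ.inv.conj_mem hP

theorem of_conj_mem {φ : Gate n} (h₁ : ∀ P ∈ pauliGroup n, φ * P * φ⁻¹ ∈ pauliGroup n)
    (h₂ : ∀ P ∈ pauliGroup n, φ⁻¹ * P * φ ∈ pauliGroup n) : IsClifford φ := by
  refine fun P => ⟨h₁ P, fun h => ?_⟩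
  convert h₂ _ h using 1
  change P = φ⁻¹ * (φ * P * φ⁻¹) * φ
  group

protected theorem mul {φ ψ : Gate n} (hφ : IsClifford φ) (hψ : IsClifford ψ) :
    IsClifford (φ * ψ) := by
  refine of_conj_mem (fun P hP => ?_) (fun P hP => ?_)
  · convert hφ.conj_mem (hψ.conj_mem hP) using 1
    group
  · convert hψ.conj_mem' (hφ.conj_mem' hP) using 1
    group

theorem of_mem_pauliGroup {P : Gate n} (hP : P ∈ pauliGroup n) : IsClifford P :=
  of_conj_mem
    (fun _ hQ => (pauliSubgroup n).mul_mem ((pauliSubgroup n).mul_mem hP hQ)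
      ((pauliSubgroup n).inv_mem hP))
    (fun _ hQ => (pauliSubgroup n).mul_mem ((pauliSubgroup n).mul_mem
      ((pauliSubgroup n).inv_mem hP) hQ) hP)

end IsClifford

theorem mem_cliffordLevel_succ {k : ℕ} {U : Gate n} :
    U ∈ cliffordLevel n (k + 2) ↔
      ∀ P ∈ pauliGroup n, U * P * U⁻¹ ∈ cliffordLevel n (k + 1) := Iff.rfl

theorem conj_mem_cliffordLevel {φ : Gate n} (hφ : IsClifford φ) {k : ℕ} {U : Gate n}
    (hU : U ∈ cliffordLevel n (k + 1)) : φ * U * φ⁻¹ ∈ cliffordLevel n (k + 1) := by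
  induction k generalizing U with
  | zero => exact hφ.conj_mem hU
  | succ k ih =>
    intro P hP
    convert ih (hU _ (hφ.conj_mem' hP)) using 1
    change φ * U * φ⁻¹ * P * (φ * U * φ⁻¹)⁻¹ = φ * (U * (φ⁻¹ * P * φ) * U⁻¹) * φ⁻¹
    group

theorem clifford_mul_mem_cliffordLevel {φ : Gate n} (hφ : IsClifford φ) {k : ℕ} {U : Gate n}
    (hU : U ∈ cliffordLevel n (k + 2)) : φ * U ∈ cliffordLevel n (k + 2) := by
  rw [mem_cliffordLevel_succ] at *
  intro P hP
  convert conj_mem_cliffordLevel hφ (hU P hP) using 1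
  group

theorem mul_clifford_mem_cliffordLevel {φ : Gate n} (hφ : IsClifford φ) {k : ℕ} {U : Gate n}
    (hU : U ∈ cliffordLevel n (k + 2)) : U * φ ∈ cliffordLevel n (k + 2) := by
  rw [mem_cliffordLevel_succ] at *
  intro P hP
  convert hU _ (hφ.conj_mem hP) using 1
  group

theorem pauli_mul_mem_cliffordLevel {P : Gate n} (hP : P ∈ pauliGroup n) {k : ℕ} {U : Gate n}
    (hU : U ∈ cliffordLevel n (k + 1)) : P * U ∈ cliffordLevel n (k + 1) := by
  cases k with
  | zero => exact (pauliSubgroup n).mul_mem hP hU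
  | succ k => exact clifford_mul_mem_cliffordLevel (.of_mem_pauliGroup hP) hU

theorem pauli_mul_mem_cliffordLevel_iff {P : Gate n} (hP : P ∈ pauliGroup n) {k : ℕ}
    {U : Gate n} : P * U ∈ cliffordLevel n (k + 1) ↔ U ∈ cliffordLevel n (k + 1) := by
  refine ⟨fun h => ?_, pauli_mul_mem_cliffordLevel hP⟩
  simpa using pauli_mul_mem_cliffordLevel ((pauliSubgroup n).inv_mem hP) h

/-! ### Degree and the hierarchy -/

/-- A diagonal sign gate `|v⟩ ↦ (-1)^{g v} |v⟩` in level `k + 1` has `deg g ≤ k + 1`: its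
commutator with `X^a` is the diagonal sign gate of the finite difference `Δ_a g`. -/
theorem degreeLT_of_mono_one_mem {k : ℕ} {g : Bits n → ZMod 2}
    (h : mono 1 g ∈ cliffordLevel n (k + 1)) : DegreeLT (k + 2) g := by
  induction k generalizing g with
  | zero =>
    obtain ⟨c, a, ℓ, hc⟩ := (mem_pauliGroup_iff _).1 h
    have h1 : phase (1 : rootsOfUnity 4 ℂ) * mono 1 g = phase c * mono (Equiv.addRight a) ℓ := by
      rw [map_one, one_mul, hc, pauliXZ]
    have h2 := (phase_mono_inj h1).2
    refine DegreeLT.of_additive fun v w => ?_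
    rw [h2 (v + w), h2 v, h2 w, map_add, map_zero]
    ring
  | succ k ih =>
    intro a
    apply ih
    rw [← pauli_mul_mem_cliffordLevel_iff (pauliXZ_mem a 0)]
    convert h _ (pauliXZ_mem a 0) using 1
    change _ = mono 1 g * pauliXZ a 0 * (mono 1 g)⁻¹
    rw [eq_mul_inv_iff_mul_eq, pauliXZ, mono_mul, mono_mul, mono_mul]
    congr 1
    ext v
    simp [fwdDiff]

/-- The inverse of a permutation in level `k + 2` has degree at most `k + 1`. -/
theorem degreeLT_of_permGate_mem {k : ℕ} {σ : Equiv.Perm (Bits n)}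
    (h : permGate σ ∈ cliffordLevel n (k + 2)) (ℓ : Bits n →ₗ[ZMod 2] ZMod 2) :
    DegreeLT (k + 2) (fun v => ℓ (σ⁻¹ v)) := by
  apply degreeLT_of_mono_one_mem
  convert h _ (pauliXZ_mem 0 ℓ) using 1
  change _ = permGate σ * pauliXZ 0 ℓ * (permGate σ)⁻¹
  rw [eq_mul_inv_iff_mul_eq, pauliXZ, permGate_eq_mono, mono_mul, mono_mul]
  congr 1
  · ext1 v
    simp
  · ext v
    simp

theorem add_self_bits (v : Bits n) : v + v = 0 := by
  ext i
  exact CharTwo.add_self_eq_zero _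

/-- Additive functions over `𝔽₂` are linear, hence functions of degree at most one are affine. -/
theorem exists_linearForm_of_degreeLT_two {g : Bits n → ZMod 2} (hg : DegreeLT 2 g) :
    ∃ ℓ : Bits n →ₗ[ZMod 2] ZMod 2, ∀ v, g v = ℓ v + g 0 :=
  ⟨(AddMonoidHom.mk' (fun v => g v - g 0) hg.map_add_of_two).toZModLinearMap 2, fun v => by
    simp⟩

/-- The gates `|v⟩ ↦ (-1)^{g v} |v + f v⟩`, where `f` and `g` are invariant under translation by
values of `f`, lie in level `k + 1` if `deg f ≤ k` and `deg g ≤ k + 1`. The class is stable under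
commutators with Pauli gates: the commutator with `X^a Z^ℓ` has `f` replaced by `Δ_a f` and `g` by
`Δ_a g + ℓ ∘ f (· + a)`, both of smaller degree. -/
theorem mono_mem_cliffordLevel {k : ℕ} {σ : Equiv.Perm (Bits n)} {f : Bits n → Bits n}
    {g : Bits n → ZMod 2} (hσ : ∀ v, σ v = v + f v) (hf : ∀ u v, f (v + f u) = f v)
    (hg : ∀ u v, g (v + f u) = g v) (df : DegreeLT (k + 1) f) (dg : DegreeLT (k + 2) g) :
    mono σ g ∈ cliffordLevel n (k + 1) := by
  induction k generalizing σ f g with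
  | zero =>
    have hf0 : ∀ v, f v = f 0 := fun v => by
      have h := congrFun (df v) 0
      simpa [fwdDiff, sub_eq_zero] using h
    have hσ' : σ = Equiv.addRight (f 0) := by
      ext1 v
      rw [hσ, hf0 v, Equiv.coe_addRight]
    obtain ⟨ℓ, hℓ⟩ := exists_linearForm_of_degreeLT_two dg
    obtain ⟨r, hr⟩ := exists_phase_mono (n := n) (g 0)
    refine (mem_pauliGroup_iff _).2 ⟨r, f 0, ℓ, ?_⟩
    rw [pauliXZ, ← hr, hσ']
    congr 1
    ext v
    exact hℓ v
  | succ k ih =>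
    intro P hP
    obtain ⟨c, a, ℓ, rfl⟩ := (mem_pauliGroup_iff P).1 hP
    have key : ∀ u v, f (v + (f (u + a) - f u)) = f v := by
      intro u v
      rw [← hf u, add_assoc, sub_add_cancel, hf]
    have key' : ∀ u v, g (v + (f (u + a) - f u)) = g v := by
      intro u v
      rw [← hg u, add_assoc, sub_add_cancel, hg]
    have hf' : ∀ u v, fwdDiff a f (v + fwdDiff a f u) = fwdDiff a f v := by
      intro u v
      simp only [fwdDiff, key, add_right_comm _ _ a]
    have hinv : Function.Involutive fun v => v + fwdDiff a f v := by
      intro v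
      simp only [hf', add_assoc, add_self_bits, add_zero]
    have hmem := ih (σ := hinv.toPerm) (f := fwdDiff a f)
      (g := fwdDiff a g + fun v => ℓ (f (v + a))) (fun v => rfl) hf' (by
        intro u v
        simp only [fwdDiff, Pi.add_apply, key, key', add_right_comm _ _ a])
      (df a) ((dg a).add ((df.translate a).map ℓ.toAddMonoidHom))
    convert pauli_mul_mem_cliffordLevel hP hmem using 1
    change mono σ g * (phase c * pauliXZ a ℓ) * (mono σ g)⁻¹ = _
    rw [mul_inv_eq_iff_eq_mul, phase_left_comm, mul_assoc, mul_assoc, pauliXZ, mono_mul, mono_mul,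
      mono_mul]
    have hff : ∀ v, fwdDiff a f (v + f v) = fwdDiff a f v := by
      intro v
      simp only [fwdDiff, hf, add_right_comm _ _ a]
    have hgg : ∀ v, fwdDiff a g (v + f v) = fwdDiff a g v := by
      intro v
      simp only [fwdDiff, hg, add_right_comm _ _ a]
    congr 2
    · ext1 v
      simp only [Equiv.Perm.mul_apply, Equiv.coe_addRight, hσ, Function.Involutive.coe_toPerm, hff]
      simp only [fwdDiff]
      abel
    · ext v
      simp only [Equiv.Perm.mul_apply, Equiv.coe_addRight, hσ, Function.Involutive.coe_toPerm, hff,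
        hgg, Pi.add_apply, add_right_comm _ _ a, hf, map_add]
      have h2 : ∀ x : ZMod 2, x + x = 0 := CharTwo.add_self_eq_zero
      have h3 : ℓ (fwdDiff a f v) = ℓ (f (v + a)) + ℓ (f v) := by
        rw [fwdDiff, map_sub, CharTwo.sub_eq_add]
      rw [h3, fwdDiff, CharTwo.sub_eq_add]
      linear_combination -(h2 (ℓ (f v)) + h2 (ℓ (f (v + a))) + h2 (g v))

/-! ### Mismatch-free circuits -/

namespace MCX

/-- The displacement `v ↦ v' - v` of a mismatch-free circuit `v ↦ v'`: each gate contributes the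
monomial of its controls at its target. -/
def disp (L : List (MCX n)) (v : Bits n) : Bits n :=
  (L.map fun g => Pi.single g.target (∏ c ∈ g.controls, v c)).sum

theorem disp_cons (g : MCX n) (L : List (MCX n)) (v : Bits n) :
    disp (g :: L) v = Pi.single g.target (∏ c ∈ g.controls, v c) + disp L v := by
  simp [disp]

theorem disp_append (L L' : List (MCX n)) (v : Bits n) :
    disp (L ++ L') v = disp L v + disp L' v := by
  simp [disp]

theorem disp_apply_eq_zero {L : List (MCX n)} {i : Fin n} (h : ∀ g ∈ L, g.target ≠ i)
    (v : Bits n) : disp L v i = 0 := by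
  induction L with
  | nil => simp [disp]
  | cons g L ih =>
    rw [disp_cons, Pi.add_apply, ih fun g' hg' => h g' (List.mem_cons_of_mem _ hg'), add_zero,
      Pi.single_eq_of_ne (h g List.mem_cons_self).symm]

theorem disp_congr {L : List (MCX n)} {v w : Bits n}
    (h : ∀ g ∈ L, ∀ c ∈ g.controls, v c = w c) : disp L v = disp L w := by
  unfold disp
  refine congrArg List.sum (List.map_congr_left fun g hg => ?_)
  rw [Finset.prod_congr rfl (h g hg)]

theorem act_eq (g : MCX n) (v : Bits n) :
    g.act v = v + Pi.single g.target (∏ c ∈ g.controls, v c) := by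
  ext i
  by_cases h : i = g.target
  · subst h; simp [act]
  · simp [act, h]

theorem MismatchFree.of_subset {L L' : List (MCX n)} (h : MismatchFree L) (hs : L' ⊆ L) :
    MismatchFree L' :=
  fun g hg g' hg' => h g (hs hg) g' (hs hg')

theorem MismatchFree.disp_apply_control {L : List (MCX n)} (hL : MismatchFree L) {g : MCX n}
    (hg : g ∈ L) {c : Fin n} (hc : c ∈ g.controls) (v : Bits n) : disp L v c = 0 :=
  disp_apply_eq_zero (fun h hh e => hL h hh g hg (e ▸ hc)) v

theorem MismatchFree.disp_add_disp {L : List (MCX n)} (hL : MismatchFree L) (u v : Bits n) :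
    disp L (v + disp L u) = disp L v :=
  disp_congr fun g hg c hc => by
    rw [Pi.add_apply, hL.disp_apply_control hg hc, add_zero]

theorem MismatchFree.exists_circuit_eq {L : List (MCX n)} (hL : MismatchFree L) :
    ∃ σ : Equiv.Perm (Bits n), circuit L = permGate σ ∧ ∀ v, σ v = v + disp L v := by
  induction L with
  | nil => exact ⟨1, by simp [circuit, permGate_one], by simp [disp]⟩
  | cons g L ih =>
    obtain ⟨σ, h, hσ⟩ := ih (hL.of_subset (List.subset_cons_self _ _))
    refine ⟨g.act_involutive.toPerm * σ, ?_, fun v => ?_⟩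
    · rw [← permGate_mul, ← h]
      simp [circuit, gate]
    · have hz : ∀ c ∈ g.controls, disp L v c = 0 := fun c hc =>
        disp_apply_eq_zero (fun h hh e =>
          hL h (List.mem_cons_of_mem _ hh) g List.mem_cons_self (e ▸ hc)) v
      have hp : ∏ c ∈ g.controls, (v + disp L v) c = ∏ c ∈ g.controls, v c :=
        Finset.prod_congr rfl fun c hc => by rw [Pi.add_apply, hz c hc, add_zero]
      rw [Equiv.Perm.mul_apply, Function.Involutive.coe_toPerm, hσ, act_eq, hp, disp_cons]
      abel

theorem degreeLT_disp {L : List (MCX n)} {k : ℕ} (h : ∀ g ∈ L, g.controls.card ≤ k) :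
    DegreeLT (k + 1) (disp L) := by
  induction L with
  | nil => exact DegreeLT.zero _
  | cons g L ih =>
    rw [funext (disp_cons g L)]
    refine DegreeLT.add ?_ (ih fun g' hg' => h g' (List.mem_cons_of_mem _ hg'))
    exact ((DegreeLT.monomial g.controls).mono (Nat.succ_le_succ (h g List.mem_cons_self))).map
      (AddMonoidHom.single (fun _ : Fin n => ZMod 2) g.target)

theorem MismatchFree.circuit_mem_cliffordLevel {L : List (MCX n)} (hL : MismatchFree L) {k : ℕ}
    (h : ∀ g ∈ L, g.controls.card ≤ k) : circuit L ∈ cliffordLevel n (k + 1) := by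
  obtain ⟨σ, hc, hσ⟩ := hL.exists_circuit_eq
  rw [hc, permGate_eq_mono]
  exact mono_mem_cliffordLevel hσ hL.disp_add_disp (fun _ _ => rfl) (degreeLT_disp h)
    (DegreeLT.zero _)

theorem MismatchFree.circuit_mul_self {L : List (MCX n)} (hL : MismatchFree L) :
    circuit L * circuit L = 1 := by
  obtain ⟨σ, hc, hσ⟩ := hL.exists_circuit_eq
  rw [hc, permGate_mul, ← permGate_one]
  congr 1
  ext1 v
  rw [Equiv.Perm.mul_apply, hσ, hσ, hL.disp_add_disp, add_assoc, add_self_bits, add_zero,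
    Equiv.Perm.one_apply]

theorem MismatchFree.isPermutation_circuit {L : List (MCX n)} (hL : MismatchFree L) :
    IsPermutation (circuit L) := by
  obtain ⟨σ, hc, -⟩ := hL.exists_circuit_eq
  exact ⟨σ, hc⟩

/-- A self-inverse gate in the second level is Clifford, and mismatch-free circuits are
self-inverse. -/
theorem MismatchFree.isClifford_circuit {L : List (MCX n)} (hL : MismatchFree L)
    (h : ∀ g ∈ L, g.controls.card ≤ 1) : IsClifford (circuit L) := by
  have h2 := mem_cliffordLevel_succ.1 (hL.circuit_mem_cliffordLevel h)
  have hi : (circuit L)⁻¹ = circuit L := inv_eq_of_mul_eq_one_right hL.circuit_mul_self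
  rw [hi] at h2
  refine IsClifford.of_conj_mem (fun P hP => ?_) (fun P hP => ?_)
  · rw [hi]; exact h2 P hP
  · rw [hi]; exact h2 P hP

theorem MismatchFree.circuit_filter {L : List (MCX n)} (hL : MismatchFree L) (p : MCX n → Bool) :
    circuit L = circuit (L.filter p) * circuit (L.filter fun g => !p g) := by
  unfold circuit
  rw [← List.prod_append, ← List.map_append]
  refine (List.Perm.prod_eq' ((List.filter_append_perm p L).symm.map gate) ?_)
  rw [List.pairwise_map]
  exact List.pairwise_of_forall_mem_list fun g hg g' hg' =>
    (mismatchFree_iff_commute L).1 hL g hg g' hg'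

theorem exists_list_of_monomials {t : Fin n} {k : ℕ} (M : List (Finset (Fin n)))
    (hM : ∀ S ∈ M, t ∉ S ∧ S.card ≤ k) :
    ∃ L : List (MCX n), (∀ g ∈ L, g.target = t ∧ g.controls ∈ M) ∧
      ∀ v, disp L v = Pi.single t (M.map fun S => ∏ s ∈ S, v s).sum := by
  induction M with
  | nil => exact ⟨[], by simp, by simp [disp]⟩
  | cons S M ih =>
    obtain ⟨L, h, hL⟩ := ih fun S' hS' => hM S' (List.mem_cons_of_mem _ hS')
    refine ⟨⟨t, S, (hM S List.mem_cons_self).1⟩ :: L, ?_, fun v => ?_⟩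
    · intro g hg
      rcases List.mem_cons.1 hg with rfl | hg
      · exact ⟨rfl, List.mem_cons_self⟩
      · exact ⟨(h g hg).1, List.mem_cons_of_mem _ (h g hg).2⟩
    · rw [disp_cons, hL, List.map_cons, List.sum_cons, Pi.single_add]

/-- A displacement of degree at most `k` that moves only the coordinates in `T`, and depends only on
the others, is realized by a mismatch-free circuit with at most `k` controls per gate. -/
theorem exists_mismatchFree_of_degreeLT {T : Finset (Fin n)} {f : Bits n → Bits n} {k : ℕ}
    (hT : ∀ v, ∀ i ∉ T, f v i = 0) (hf : DependsOn f ((Tᶜ : Finset (Fin n)) : Set (Fin n)))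
    (df : ∀ i, DegreeLT (k + 1) fun v => f v i) :
    ∃ L : List (MCX n), MismatchFree L ∧ (∀ g ∈ L, g.controls.card ≤ k) ∧ disp L = f := by
  have key : ∀ t ∈ T, ∃ L : List (MCX n),
      (∀ g ∈ L, g.target = t ∧ g.controls ⊆ Tᶜ ∧ g.controls.card ≤ k) ∧
        ∀ v, disp L v = Pi.single t (f v t) := by
    intro t ht
    obtain ⟨M, hM, hs⟩ := (df t).exists_monomials Tᶜ fun v w h => congrFun (hf h) t
    obtain ⟨L, hL, hd⟩ := exists_list_of_monomials (t := t) (k := k) M fun S hS =>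
      ⟨fun h => Finset.mem_compl.1 ((hM S hS).1 h) ht, Nat.lt_succ_iff.1 (hM S hS).2⟩
    refine ⟨L, fun g hg => ⟨(hL g hg).1, (hM _ (hL g hg).2).1,
      Nat.lt_succ_iff.1 (hM _ (hL g hg).2).2⟩, fun v => ?_⟩
    rw [hd, hs]
  have sum : ∀ U ⊆ T, ∃ L : List (MCX n),
      (∀ g ∈ L, g.target ∈ T ∧ g.controls ⊆ Tᶜ ∧ g.controls.card ≤ k) ∧
        ∀ v, disp L v = ∑ t ∈ U, Pi.single t (f v t) := by
    intro U
    induction U using Finset.induction_on with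
    | empty => exact fun _ => ⟨[], by simp, by simp [disp]⟩
    | insert t U ht ih =>
      intro hU
      have htT : t ∈ T := hU (Finset.mem_insert_self _ _)
      obtain ⟨L₁, h₁, e₁⟩ := key t htT
      obtain ⟨L₂, h₂, e₂⟩ := ih ((Finset.subset_insert _ _).trans hU)
      refine ⟨L₁ ++ L₂, fun g hg => ?_, fun v => ?_⟩
      · rcases List.mem_append.1 hg with hg | hg
        · exact ⟨(h₁ g hg).1 ▸ htT, (h₁ g hg).2⟩
        · exact h₂ g hg
      · rw [disp_append, e₁, e₂, Finset.sum_insert ht]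
  obtain ⟨L, hL, e⟩ := sum T subset_rfl
  refine ⟨L, fun g hg h hh hm => Finset.mem_compl.1 ((hL h hh).2.1 hm) (hL g hg).1,
    fun g hg => (hL g hg).2.2, funext fun v => ?_⟩
  rw [e]
  conv_rhs => rw [← Finset.univ_sum_single (f v)]
  refine Finset.sum_subset (Finset.subset_univ T) fun i _ hi => ?_
  rw [hT v i hi, Pi.single_zero]

end MCX

/-! ### Hadamard gates and shears -/

theorem tensor_mul (P Q : Fin n → Matrix (ZMod 2) (ZMod 2) ℂ) :
    tensor P * tensor Q = tensor fun i => P i * Q i := by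
  ext a b
  simp only [tensor, Matrix.mul_apply, Matrix.of_apply, ← Finset.prod_mul_distrib]
  exact (Fintype.prod_sum fun i j => P i (a i) j * Q i j (b i)).symm

theorem tensor_one : tensor (fun _ : Fin n => (1 : Matrix (ZMod 2) (ZMod 2) ℂ)) = 1 := by
  ext a b
  simp only [tensor, Matrix.of_apply, Matrix.one_apply, Finset.prod_ite_zero]
  simp [funext_iff]

/-- The single-qubit Hadamard matrix. -/
def hadamard : Matrix (ZMod 2) (ZMod 2) ℂ :=
  Matrix.of fun x y => sgn (x * y) * ((Real.sqrt 2 : ℝ) : ℂ)⁻¹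

theorem inv_sqrt_two_mul_self :
    ((Real.sqrt 2 : ℝ) : ℂ)⁻¹ * ((Real.sqrt 2 : ℝ) : ℂ)⁻¹ = 2⁻¹ := by
  rw [← mul_inv, ← Complex.ofReal_mul, Real.mul_self_sqrt (by norm_num)]
  norm_num

theorem sum_zmod_two (f : ZMod 2 → ℂ) : ∑ x, f x = f 0 + f 1 := Fin.sum_univ_two f

theorem hadamard_mul_self : hadamard * hadamard = 1 := by
  have h := inv_sqrt_two_mul_self
  have e : ∀ x y, (hadamard * hadamard) x y = 2⁻¹ * (1 + sgn (x + y)) := by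
    intro x y
    simp only [hadamard, Matrix.mul_apply, sum_zmod_two, Matrix.of_apply, mul_zero, zero_mul,
      mul_one, one_mul, sgn_zero, sgn_add]
    linear_combination (1 + sgn x * sgn y) * h
  ext x y
  rw [e]
  rcases zmod_two_cases x with rfl | rfl <;> rcases zmod_two_cases y with rfl | rfl <;>
    simp only [CharTwo.add_self_eq_zero, add_zero, zero_add, sgn_zero, sgn_one,
      Matrix.one_apply, if_true, zero_ne_one, one_ne_zero, if_false] <;> norm_num

theorem star_hadamard : star hadamard = hadamard := by
  ext x y
  simp [hadamard, Matrix.star_apply, mul_comm, star_sgn]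

theorem hadamard_conj_single_qubit {P : Matrix (ZMod 2) (ZMod 2) ℂ}
    (hP : P = 1 ∨ P = pauliX ∨ P = pauliY ∨ P = pauliZ) :
    ∃ (c : ℂ) (Q : Matrix (ZMod 2) (ZMod 2) ℂ), c ^ 4 = 1 ∧
      (Q = 1 ∨ Q = pauliX ∨ Q = pauliY ∨ Q = pauliZ) ∧ hadamard * P * hadamard = c • Q := by
  have h := inv_sqrt_two_mul_self
  rcases hP with rfl | rfl | rfl | rfl
  · exact ⟨1, 1, by norm_num, by simp, by rw [mul_one, hadamard_mul_self, one_smul]⟩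
  · refine ⟨1, pauliZ, by norm_num, by simp, ?_⟩
    ext x y
    rcases zmod_two_cases x with rfl | rfl <;> rcases zmod_two_cases y with rfl | rfl <;>
      simp [hadamard, pauliX, pauliZ, Matrix.mul_apply, sum_zmod_two] <;>
      first | linear_combination 2 * h | linear_combination -2 * h
  · refine ⟨-1, pauliY, by norm_num, by simp, ?_⟩
    ext x y
    rcases zmod_two_cases x with rfl | rfl <;> rcases zmod_two_cases y with rfl | rfl <;>
      simp [hadamard, pauliY, Matrix.mul_apply, sum_zmod_two] <;>
      first | linear_combination 2 * Complex.I * h | linear_combination -2 * Complex.I * h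
  · refine ⟨1, pauliX, by norm_num, by simp, ?_⟩
    ext x y
    rcases zmod_two_cases x with rfl | rfl <;> rcases zmod_two_cases y with rfl | rfl <;>
      simp [hadamard, pauliX, pauliZ, Matrix.mul_apply, sum_zmod_two] <;>
      linear_combination 2 * h

theorem star_tensor (P : Fin n → Matrix (ZMod 2) (ZMod 2) ℂ) :
    star (tensor P) = tensor fun i => star (P i) := by
  ext a b
  simp [tensor, Matrix.star_apply]

theorem tensor_smul (c : Fin n → ℂ) (P : Fin n → Matrix (ZMod 2) (ZMod 2) ℂ) :
    (tensor fun i => c i • P i) = (∏ i, c i) • tensor P := by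
  ext a b
  simp [tensor, Finset.prod_mul_distrib]

/-- The single-qubit factors of the Hadamard gate on the qubits in `T`. -/
def hadamardFactor (T : Finset (Fin n)) (i : Fin n) : Matrix (ZMod 2) (ZMod 2) ℂ :=
  if i ∈ T then hadamard else 1

theorem hadamardFactor_mul_self (T : Finset (Fin n)) (i : Fin n) :
    hadamardFactor T i * hadamardFactor T i = 1 := by
  unfold hadamardFactor
  split_ifs
  · exact hadamard_mul_self
  · exact mul_one 1

theorem star_hadamardFactor (T : Finset (Fin n)) (i : Fin n) :
    star (hadamardFactor T i) = hadamardFactor T i := by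
  unfold hadamardFactor
  split_ifs
  · exact star_hadamard
  · exact star_one _

/-- The Hadamard gate on the qubits in `T`. -/
def hadamardGate (T : Finset (Fin n)) : Gate n :=
  ⟨tensor (hadamardFactor T), by
    rw [Matrix.mem_unitaryGroup_iff, star_tensor, tensor_mul]
    simp only [star_hadamardFactor, hadamardFactor_mul_self, tensor_one]⟩

theorem hadamardGate_mul_self (T : Finset (Fin n)) : hadamardGate T * hadamardGate T = 1 := by
  apply Subtype.ext
  change tensor (hadamardFactor T) * tensor (hadamardFactor T) = 1
  simp only [tensor_mul, hadamardFactor_mul_self, tensor_one]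

theorem isClifford_hadamardGate (T : Finset (Fin n)) : IsClifford (hadamardGate T) := by
  have hi : (hadamardGate T)⁻¹ = hadamardGate T :=
    inv_eq_of_mul_eq_one_right (hadamardGate_mul_self T)
  have key : ∀ P ∈ pauliGroup n, hadamardGate T * P * hadamardGate T ∈ pauliGroup n := by
    rintro U ⟨c, P, hc, hP, hU⟩
    have hex : ∀ i, ∃ (d : ℂ) (Q : Matrix (ZMod 2) (ZMod 2) ℂ), d ^ 4 = 1 ∧
        (Q = 1 ∨ Q = pauliX ∨ Q = pauliY ∨ Q = pauliZ) ∧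
        hadamardFactor T i * P i * hadamardFactor T i = d • Q := by
      intro i
      unfold hadamardFactor
      split_ifs
      · exact hadamard_conj_single_qubit (hP i)
      · exact ⟨1, P i, by norm_num, hP i, by rw [mul_one, one_mul, one_smul]⟩
    choose d Q hd hQ hconj using hex
    refine ⟨c * ∏ i, d i, Q, ?_, hQ, ?_⟩
    · rw [← pow_four_eq_one_iff, mul_pow, (pow_four_eq_one_iff c).2 hc, ← Finset.prod_pow]
      simp [hd]
    · change tensor (hadamardFactor T) * U.1 * tensor (hadamardFactor T) = _
      rw [hU, mul_smul_comm, smul_mul_assoc, tensor_mul, tensor_mul]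
      simp only [hconj]
      rw [tensor_smul, smul_smul]
  exact IsClifford.of_conj_mem (by rwa [hi]) (by rwa [hi])

theorem permMat_mul_apply (σ : Equiv.Perm (Bits n)) (M : Matrix (Bits n) (Bits n) ℂ)
    (v w : Bits n) : (permMat σ * M) v w = M (σ⁻¹ v) w := by
  simp only [Matrix.mul_apply, permMat, Matrix.of_apply, ite_mul, one_mul, zero_mul]
  rw [Finset.sum_eq_single (σ⁻¹ v) (fun u _ hu => if_neg fun h => hu (by simp [h])) (by simp),
    if_pos (by simp)]

theorem mul_monoMat_one_apply (g : Bits n → ZMod 2) (M : Matrix (Bits n) (Bits n) ℂ)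
    (v w : Bits n) : (M * monoMat 1 g) v w = M v w * sgn (g w) := by
  have h : monoMat 1 g = Matrix.diagonal fun w => sgn (g w) := by
    ext u w
    by_cases e : u = w
    · subst e; simp [monoMat]
    · simp [monoMat, e]
  rw [h, Matrix.mul_diagonal]

/-- Conjugation by Hadamard gates on the moved qubits `T` turns the shear `v ↦ v + f v` into the
diagonal gate with sign `(-1)^{∑ t, v t * f v t}`. -/
theorem permGate_mul_hadamardGate {T : Finset (Fin n)} {f : Bits n → Bits n}
    {σ : Equiv.Perm (Bits n)} (hσ : ∀ v, σ v = v + f v) (hT : ∀ v, ∀ i ∉ T, f v i = 0)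
    (hf : DependsOn f ((Tᶜ : Finset (Fin n)) : Set (Fin n))) :
    permGate σ * hadamardGate T = hadamardGate T * mono 1 fun w => ∑ t, w t * f w t := by
  have hff : ∀ v, f (v + f v) = f v := fun v => hf fun i hi => by
    rw [Pi.add_apply, hT v i (Finset.mem_compl.1 hi), add_zero]
  have hσσ : ∀ v, σ (σ v) = v := fun v => by
    rw [hσ, hσ, hff, add_assoc, add_self_bits, add_zero]
  apply Subtype.ext
  change permMat σ * tensor (hadamardFactor T) = tensor (hadamardFactor T) * monoMat 1 _
  ext v w
  rw [permMat_mul_apply, mul_monoMat_one_apply, tensor, Matrix.of_apply, Matrix.of_apply, sgn_sum,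
    ← Finset.prod_mul_distrib, show σ⁻¹ v = σ v from σ.injective (by simp [hσσ])]
  by_cases h : ∀ i ∉ T, v i = w i
  · have hvw : f v = f w := hf fun i hi => h i (Finset.mem_compl.1 hi)
    refine Finset.prod_congr rfl fun i _ => ?_
    rw [hσ, hvw, Pi.add_apply]
    unfold hadamardFactor
    split_ifs with hi
    · simp only [hadamard, Matrix.of_apply, add_mul, sgn_add, mul_comm (w i)]
      ring
    · rw [hT w i hi, add_zero, mul_zero, sgn_zero, mul_one]
  · push Not at h
    obtain ⟨i, hi, hne⟩ := h
    rw [Finset.prod_eq_zero (Finset.mem_univ i), Finset.prod_eq_zero (Finset.mem_univ i)]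
    · rw [hadamardFactor, if_neg hi, Matrix.one_apply_ne hne, zero_mul]
    · rw [hadamardFactor, if_neg hi, hσ, Pi.add_apply, hT v i hi, add_zero,
        Matrix.one_apply_ne hne]

theorem IsSemiClifford.clifford_mul_mul {U φ₁ φ₂ : Gate n} (hU : IsSemiClifford U)
    (h₁ : IsClifford φ₁) (h₂ : IsClifford φ₂) : IsSemiClifford (φ₁ * U * φ₂) := by
  obtain ⟨ψ₁, d, ψ₂, hψ₁, hd, hψ₂, rfl⟩ := hU
  exact ⟨φ₁ * ψ₁, d, ψ₂ * φ₂, h₁.mul hψ₁, hd, hψ₂.mul h₂, by simp only [mul_assoc]⟩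

theorem isDiagonal_mono_one (g : Bits n → ZMod 2) : IsDiagonal (mono 1 g) := fun v w h => by
  simp [mono, monoMat, h]

theorem MCX.MismatchFree.isSemiClifford_circuit {L : List (MCX n)} (hL : MCX.MismatchFree L) :
    IsSemiClifford (MCX.circuit L) := by
  classical
  obtain ⟨σ, hc, hσ⟩ := hL.exists_circuit_eq
  set T : Finset (Fin n) := (L.map MCX.target).toFinset with hTdef
  have hmem : ∀ g ∈ L, g.target ∈ T := fun g hg => by
    rw [hTdef, List.mem_toFinset]
    exact List.mem_map_of_mem hg
  have hT : ∀ v, ∀ i ∉ T, MCX.disp L v i = 0 := fun v i hi =>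
    MCX.disp_apply_eq_zero (fun g hg (e : g.target = i) => hi (e ▸ hmem g hg)) v
  have hf : DependsOn (MCX.disp L) ((Tᶜ : Finset (Fin n)) : Set (Fin n)) := fun v w h =>
    MCX.disp_congr fun g hg c hcg => h c <| by
      rw [Finset.mem_coe, Finset.mem_compl, hTdef, List.mem_toFinset, List.mem_map]
      rintro ⟨g', hg', rfl⟩
      exact hL g' hg' g hg hcg
  refine ⟨hadamardGate T, _, hadamardGate T, isClifford_hadamardGate T,
    isDiagonal_mono_one fun w => ∑ t, w t * MCX.disp L w t, isClifford_hadamardGate T, ?_⟩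
  rw [← permGate_mul_hadamardGate hσ hT hf, mul_assoc, hadamardGate_mul_self, mul_one, hc]

/-! ### Affine permutations are Clifford -/

theorem permGate_inv (σ : Equiv.Perm (Bits n)) : (permGate σ)⁻¹ = permGate σ⁻¹ :=
  inv_eq_of_mul_eq_one_right (by rw [permGate_mul, mul_inv_cancel, permGate_one])

theorem IsPermutation.mul {U V : Gate n} (hU : IsPermutation U) (hV : IsPermutation V) :
    IsPermutation (U * V) := by
  obtain ⟨σ, rfl⟩ := hU
  obtain ⟨τ, rfl⟩ := hV
  exact ⟨σ * τ, permGate_mul σ τ⟩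

theorem permGate_linearEquiv_conj_mem (S : Bits n ≃ₗ[ZMod 2] Bits n) {P : Gate n}
    (hP : P ∈ pauliGroup n) :
    permGate S.toEquiv * P * (permGate S.toEquiv)⁻¹ ∈ pauliGroup n := by
  obtain ⟨c, a, ℓ, rfl⟩ := (mem_pauliGroup_iff P).1 hP
  refine (mem_pauliGroup_iff _).2 ⟨c, S a, ℓ ∘ₗ S.symm.toLinearMap, ?_⟩
  rw [mul_inv_eq_iff_eq_mul, phase_left_comm, mul_assoc, permGate_eq_mono, pauliXZ, pauliXZ,
    mono_mul, mono_mul]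
  congr 2
  · ext1 v
    simp
  · ext v
    simp

theorem isClifford_permGate_linearEquiv (S : Bits n ≃ₗ[ZMod 2] Bits n) :
    IsClifford (permGate S.toEquiv) := by
  refine IsClifford.of_conj_mem (fun P hP => permGate_linearEquiv_conj_mem S hP) fun P hP => ?_
  have h := permGate_linearEquiv_conj_mem S.symm hP
  have e : permGate S.symm.toEquiv = (permGate S.toEquiv)⁻¹ := by
    rw [permGate_inv]
    rfl
  rwa [e, inv_inv] at h

theorem isClifford_permGate_addRight (a : Bits n) : IsClifford (permGate (Equiv.addRight a)) := by
  refine IsClifford.of_mem_pauliGroup ?_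
  have h := pauliXZ_mem a 0
  rwa [pauliXZ, show ((0 : Bits n →ₗ[ZMod 2] ZMod 2) : Bits n → ZMod 2) = 0 from rfl,
    ← permGate_eq_mono] at h

/-! ### The normal form of a semi-Clifford permutation -/

/-- The linear forms that pull back to affine forms under `σ⁻¹`: those `ℓ` for which the
permutation gate of `σ` conjugates the gate `Z^ℓ` to a Pauli gate. -/
def affineForms (σ : Equiv.Perm (Bits n)) : Submodule (ZMod 2) (Module.Dual (ZMod 2) (Bits n)) where
  carrier := {ℓ | ∃ (m : Module.Dual (ZMod 2) (Bits n)) (e : ZMod 2), ∀ v, ℓ v = m (σ v) + e}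
  zero_mem' := ⟨0, 0, by simp⟩
  add_mem' := by
    rintro ℓ ℓ' ⟨m, e, h⟩ ⟨m', e', h'⟩
    refine ⟨m + m', e + e', fun v => ?_⟩
    rw [LinearMap.add_apply, LinearMap.add_apply, h, h']
    ring
  smul_mem' := by
    rintro c ℓ ⟨m, e, h⟩
    refine ⟨c • m, c * e, fun v => ?_⟩
    rw [LinearMap.smul_apply, LinearMap.smul_apply, h, smul_eq_mul, smul_eq_mul]
    ring

/-- If the gate of a permutation `σ` conjugates `X^a Z^ℓ` to a Pauli gate, it does so to `X^a` and
`Z^ℓ` separately. -/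
theorem of_permGate_conj_mem {σ : Equiv.Perm (Bits n)} {a : Bits n}
    {ℓ : Bits n →ₗ[ZMod 2] ZMod 2} {c : rootsOfUnity 4 ℂ}
    (h : permGate σ * (phase c * pauliXZ a ℓ) * (permGate σ)⁻¹ ∈ pauliGroup n) :
    (∃ a', ∀ v, σ (v + a) = σ v + a') ∧ ℓ ∈ affineForms σ := by
  obtain ⟨d, b, m, hd⟩ := (mem_pauliGroup_iff _).1 h
  rw [mul_inv_eq_iff_eq_mul, phase_left_comm, mul_assoc, permGate_eq_mono, pauliXZ, pauliXZ,
    mono_mul, mono_mul] at hd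
  obtain ⟨h1, h2⟩ := phase_mono_inj hd
  refine ⟨⟨b, fun v => ?_⟩, ⟨m, m (σ 0), fun v => ?_⟩⟩
  · simpa using Equiv.congr_fun h1 v
  · simpa using h2 v

theorem IsDiagonal.commute {d e : Gate n} (hd : IsDiagonal d) (he : IsDiagonal e) :
    d * e = e * d := by
  apply Subtype.ext
  change d.1 * e.1 = e.1 * d.1
  rw [← hd.diagonal_diag, ← he.diagonal_diag, Matrix.diagonal_mul_diagonal,
    Matrix.diagonal_mul_diagonal]
  simp only [mul_comm]

theorem isDiagonal_phase_mul {d : Gate n} (hd : IsDiagonal d) (c : rootsOfUnity 4 ℂ) :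
    IsDiagonal (phase c * d) := by
  unfold IsDiagonal
  rw [coe_phase_mul]
  exact hd.smul _

theorem isDiagonal_pauliXZ_zero (ℓ : Bits n →ₗ[ZMod 2] ZMod 2) : IsDiagonal (pauliXZ 0 ℓ) := by
  have : Equiv.addRight (0 : Bits n) = 1 := by
    ext1 v
    simp
  rw [pauliXZ, this]
  exact isDiagonal_mono_one _

/-- A Pauli gate commuting with all `Z^ℓ` is diagonal. -/
theorem isDiagonal_of_commute {P : Gate n} (hP : P ∈ pauliGroup n)
    (h : ∀ ℓ, P * pauliXZ 0 ℓ = pauliXZ 0 ℓ * P) : IsDiagonal P := by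
  obtain ⟨c, a, m, rfl⟩ := (mem_pauliGroup_iff P).1 hP
  suffices a = 0 by
    subst this
    exact isDiagonal_phase_mul (isDiagonal_pauliXZ_zero m) c
  ext i
  have hi := h (LinearMap.proj i)
  rw [phase_left_comm, mul_assoc, mul_right_inj, pauliXZ, pauliXZ, mono_mul, mono_mul] at hi
  -- the two exponents differ by the constant `a i`, which is read off in column `0`
  have h2 := congrArg (fun U : Gate n => U.1 a 0) hi
  simp only [mono, monoMat, Matrix.of_apply, Equiv.Perm.mul_apply, Equiv.coe_addRight, zero_add,
    add_zero, if_true, map_zero, LinearMap.proj_apply, Pi.zero_apply] at h2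
  have h3 := sgn_injective h2
  exact h3.symm

/-- The key property of semi-Clifford permutations: the gate maps to a Pauli gate every `X^w` that
commutes with all `Z^ℓ` mapped to Pauli gates. For `φ₁ d φ₂`, the elements `φ₂⁻¹ Z^m φ₂`
are Pauli gates mapped to Pauli gates, so their `Z`-parts lie in `affineForms σ` and `X^w` commutes
with them. Hence `φ₂ X^w φ₂⁻¹` commutes with all `Z^m`, is therefore diagonal and
commutes with `d`. -/
theorem IsSemiClifford.exists_map_add_eq {σ : Equiv.Perm (Bits n)}
    (h : IsSemiClifford (permGate σ)) {w : Bits n} (hw : w ∈ (affineForms σ).dualCoannihilator) :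
    ∃ a, ∀ v, σ (v + w) = σ v + a := by
  obtain ⟨φ₁, d, φ₂, h₁, hd, h₂, e⟩ := h
  have hcomm : ∀ m, (φ₂ * pauliXZ w 0 * φ₂⁻¹) * pauliXZ 0 m
      = pauliXZ 0 m * (φ₂ * pauliXZ w 0 * φ₂⁻¹) := by
    intro m
    have hQ := h₂.conj_mem' (pauliXZ_mem 0 m)
    obtain ⟨c, a, ℓ, hc⟩ := (mem_pauliGroup_iff _).1 hQ
    have hℓ : ℓ ∈ affineForms σ := by
      refine (of_permGate_conj_mem (a := a) (c := c) ?_).2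
      rw [← hc, e]
      convert h₁.conj_mem (pauliXZ_mem 0 m) using 1
      have := hd.commute (isDiagonal_pauliXZ_zero m)
      calc φ₁ * d * φ₂ * (φ₂⁻¹ * pauliXZ 0 m * φ₂) * (φ₁ * d * φ₂)⁻¹
          = φ₁ * (d * pauliXZ 0 m) * d⁻¹ * φ₁⁻¹ := by group
        _ = _ := by rw [this]; group
    have hℓw : ℓ w = 0 := (Submodule.mem_dualCoannihilator w).1 hw ℓ hℓ
    have key : pauliXZ w 0 * (φ₂⁻¹ * pauliXZ 0 m * φ₂)
        = φ₂⁻¹ * pauliXZ 0 m * φ₂ * pauliXZ w 0 := by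
      rw [hc, phase_left_comm, mul_assoc, pauliXZ, pauliXZ, mono_mul, mono_mul]
      congr 2
      · ext1 v
        simp [add_right_comm]
      · ext v
        simp [hℓw]
    calc (φ₂ * pauliXZ w 0 * φ₂⁻¹) * pauliXZ 0 m
        = φ₂ * (pauliXZ w 0 * (φ₂⁻¹ * pauliXZ 0 m * φ₂)) * φ₂⁻¹ := by group
      _ = _ := by rw [key]; group
  have hdiag := isDiagonal_of_commute (h₂.conj_mem (pauliXZ_mem w 0)) hcomm
  refine (of_permGate_conj_mem (c := 1) (a := w) (ℓ := 0) ?_).1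
  rw [map_one, one_mul, e]
  have hP := h₂.conj_mem (pauliXZ_mem w 0)
  generalize hQ : φ₂ * pauliXZ w 0 * φ₂⁻¹ = Q at hdiag hP
  convert h₁.conj_mem hP using 1
  have := hd.commute hdiag
  calc φ₁ * d * φ₂ * pauliXZ w 0 * (φ₁ * d * φ₂)⁻¹
      = φ₁ * (d * (φ₂ * pauliXZ w 0 * φ₂⁻¹)) * d⁻¹ * φ₁⁻¹ := by group
    _ = _ := by rw [hQ, this]; group

/-- Every subspace of `𝔽₂ⁿ` becomes a coordinate subspace in suitable linear coordinates. -/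
theorem exists_linearEquiv_coordinates (W : Submodule (ZMod 2) (Bits n)) :
    ∃ (S : Bits n ≃ₗ[ZMod 2] Bits n) (T : Finset (Fin n)),
      ∀ v, v ∈ W ↔ ∀ i ∉ T, S v i = 0 := by
  classical
  obtain ⟨C, hWC⟩ := W.exists_isCompl
  let bW := Module.finBasis (ZMod 2) W
  let bC := Module.finBasis (ZMod 2) C
  let b := (bW.prod bC).map (Submodule.prodEquivOfIsCompl W C hWC)
  have hcard : Fintype.card (Fin (Module.finrank (ZMod 2) W) ⊕ Fin (Module.finrank (ZMod 2) C))
      = Fintype.card (Fin n) := by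
    rw [← Module.finrank_eq_card_basis b, Module.finrank_fintype_fun_eq_card]
  let e := Fintype.equivOfCardEq hcard
  refine ⟨(b.reindex e).equivFun, Finset.univ.image fun i => e (Sum.inl i), fun v => ?_⟩
  have hv : v ∈ W ↔ ((Submodule.prodEquivOfIsCompl W C hWC).symm v).2 = 0 :=
    (Submodule.prodEquivOfIsCompl_symm_apply_snd_eq_zero W C hWC).symm
  rw [hv]
  have hval : ∀ j, (b.reindex e).equivFun v (e (Sum.inr j))
      = bC.repr ((Submodule.prodEquivOfIsCompl W C hWC).symm v).2 j := by
    intro j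
    simp [b]
  constructor
  · intro h i hi
    obtain ⟨j, rfl⟩ := e.surjective i
    rcases j with j | j
    · exact absurd (Finset.mem_image_of_mem _ (Finset.mem_univ j)) hi
    · rw [hval, h]
      simp
  · intro h
    apply bC.repr.injective
    ext j
    rw [← hval, h]
    · simp
    · simp

/-- The normal form of a semi-Clifford permutation: up to affine permutations on both sides it is a
shear, which adds to the coordinates in `T` a function of the other coordinates. Here the
coordinates in `T` correspond to the annihilator `W` of `affineForms σ`: `σ` is additive in the
direction of `W`, and affine modulo `W`, since the forms vanishing on `W` pull back to affine
forms. -/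
theorem IsSemiClifford.exists_shear {σ : Equiv.Perm (Bits n)} (h : IsSemiClifford (permGate σ)) :
    ∃ (S₁ S₂ : Bits n ≃ₗ[ZMod 2] Bits n) (c : Bits n) (T : Finset (Fin n)) (f : Bits n → Bits n),
      (∀ v, ∀ i ∉ T, f v i = 0) ∧ DependsOn f ((Tᶜ : Finset (Fin n)) : Set (Fin n)) ∧
        ∀ v, S₁ (σ v) = S₂ v + f (S₂ v) + c := by
  classical
  set W := (affineForms σ).dualCoannihilator with hW
  have hWB : W.dualAnnihilator = affineForms σ := Subspace.dualCoannihilator_dualAnnihilator_eq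
  obtain ⟨S, T, hST⟩ := exists_linearEquiv_coordinates W
  -- the increment of `σ` along `W`, as a linear map
  have hM : ∀ w : W, ∀ v, σ (v + w) = σ v + (σ w - σ 0) := by
    intro w v
    obtain ⟨a, ha⟩ := h.exists_map_add_eq w.2
    have h0 := ha 0
    rw [zero_add] at h0
    rw [ha, h0, add_sub_cancel_left]
  let M : W →ₗ[ZMod 2] Bits n := (AddMonoidHom.mk' (fun w : W => σ w - σ 0) fun w w' => by
    rw [Submodule.coe_add, hM w']
    abel).toZModLinearMap 2
  have hMσ : ∀ (w : W) v, σ (v + w) = σ v + M w := hM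
  have hMinj : LinearMap.ker M = ⊥ := by
    rw [LinearMap.ker_eq_bot']
    intro w hw
    have h1 : σ w = σ 0 := sub_eq_zero.1 hw
    exact Subtype.ext (σ.injective h1)
  obtain ⟨Minv, hMinv⟩ := M.exists_leftInverse_of_injective hMinj
  have hMinv' : ∀ w, Minv (M w) = w := fun w => LinearMap.congr_fun hMinv w
  -- modulo `W`, that is in the coordinates of `S` outside `T`, `σ` is affine
  have hN : ∀ i, ∃ (m : Module.Dual (ZMod 2) (Bits n)) (e : ZMod 2),
      (∀ v, (if i ∈ T then 0 else S v i) = m (σ v) + e) ∧ (i ∈ T → m = 0) := by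
    intro i
    by_cases hi : i ∈ T
    · exact ⟨0, 0, by simp [hi], fun _ => rfl⟩
    · have hmem : (LinearMap.proj i ∘ₗ S.toLinearMap : Module.Dual (ZMod 2) (Bits n))
          ∈ affineForms σ := by
        rw [← hWB, Submodule.mem_dualAnnihilator]
        exact fun w hw => (hST w).1 hw i hi
      obtain ⟨m, e, hme⟩ := hmem
      exact ⟨m, e, fun v => by rw [if_neg hi, ← hme]; rfl, fun hi' => absurd hi' hi⟩
  choose m e hme hmT using hN
  let N : Bits n →ₗ[ZMod 2] Bits n := LinearMap.pi m
  have hNσ : ∀ v i, N (σ v) i = (if i ∈ T then 0 else S v i) - e i := by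
    intro v i
    rw [hme i v, add_sub_cancel_right]
    rfl
  have hNT : ∀ u, ∀ i ∈ T, N u i = 0 := fun u i hi => by
    change m i u = 0
    rw [hmT i hi, LinearMap.zero_apply]
  have hMinvT : ∀ u, ∀ i ∉ T, S (Minv u) i = 0 := fun u => (hST _).1 (Minv u).2
  let R : Bits n →ₗ[ZMod 2] Bits n := N + S.toLinearMap ∘ₗ W.subtype ∘ₗ Minv
  have hR : ∀ u i, R u i = N u i + S (Minv u) i := fun _ _ => rfl
  have hRinj : Function.Injective R := by
    rw [← LinearMap.ker_eq_bot, LinearMap.ker_eq_bot']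
    intro u hu
    have hNu : ∀ i ∉ T, N u i = 0 := fun i hi => by
      have := congrFun hu i
      rwa [hR, hMinvT u i hi, add_zero] at this
    have hMu : Minv u = 0 := by
      have : S (Minv u) = 0 := by
        ext i
        by_cases hi : i ∈ T
        · have := congrFun hu i
          rwa [hR, hNT u i hi, zero_add] at this
        · exact hMinvT u i hi
      exact Subtype.ext (S.map_eq_zero_iff.1 this)
    obtain ⟨v, rfl⟩ := σ.surjective u
    obtain ⟨v₀, hv₀⟩ := σ.surjective 0
    -- `N` separates the cosets of `W`, so `v` lies in the coset of the preimage `v₀` of zero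
    have hw : v - v₀ ∈ W := by
      rw [hST]
      intro i hi
      have h1 := hNu i hi
      have h2 : N (σ v₀) i = 0 := by rw [hv₀, map_zero]; rfl
      rw [hNσ, if_neg hi] at h1 h2
      rw [map_sub, Pi.sub_apply]
      linear_combination h1 - h2
    have h3 := hMσ ⟨v - v₀, hw⟩ v₀
    rw [hv₀, zero_add, Submodule.coe_mk, add_sub_cancel] at h3
    rw [h3, hMinv'] at hMu
    rw [h3, hMu, map_zero]
  refine ⟨LinearEquiv.ofInjectiveEndo R hRinj, S, -e, T,
    fun x => S (Minv (σ (S.symm fun i => if i ∈ T then 0 else x i))), fun x => hMinvT _, ?_, ?_⟩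
  · intro x y hxy
    have : (fun i => if i ∈ T then 0 else x i) = fun i => if i ∈ T then 0 else y i := by
      ext i
      split_ifs with hi
      · rfl
      · exact hxy i (by simpa using hi)
    simp only [this]
  · intro v
    set q := S.symm fun i => if i ∈ T then 0 else S v i with hq
    have hp : S.symm (fun i => if i ∈ T then S v i else 0) ∈ W := by
      rw [hST]
      intro i hi
      rw [LinearEquiv.apply_symm_apply, if_neg hi]
    have hqp : q + S.symm (fun i => if i ∈ T then S v i else 0) = v := by
      apply S.injective
      ext i
      rw [hq, map_add, LinearEquiv.apply_symm_apply, LinearEquiv.apply_symm_apply, Pi.add_apply]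
      split_ifs <;> simp
    have hσv := hMσ ⟨_, hp⟩ q
    rw [Submodule.coe_mk, hqp] at hσv
    have hMv : S (Minv (σ v)) = S (Minv (σ q)) + fun i => if i ∈ T then S v i else 0 := by
      rw [hσv, map_add, hMinv', Submodule.coe_add, map_add, Submodule.coe_mk,
        LinearEquiv.apply_symm_apply]
    ext i
    rw [LinearEquiv.coe_ofInjectiveEndo, hR, hNσ, hMv]
    simp only [Pi.add_apply, Pi.neg_apply]
    split_ifs <;> ring

/-! ### Levels of semi-Clifford permutations -/

/-- The normal form on the level of gates: Clifford permutations times a shear. -/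
theorem IsSemiClifford.exists_eq_clifford_mul_shear {π : Gate n} (hπ : IsPermutation π)
    (h : IsSemiClifford π) :
    ∃ (φ₁ φ₂ : Gate n) (μ : Equiv.Perm (Bits n)) (T : Finset (Fin n)) (f : Bits n → Bits n),
      (IsClifford φ₁ ∧ IsPermutation φ₁) ∧ (IsClifford φ₂ ∧ IsPermutation φ₂) ∧
      (∀ v, ∀ i ∉ T, f v i = 0) ∧ DependsOn f ((Tᶜ : Finset (Fin n)) : Set (Fin n)) ∧
      (∀ u v, f (v + f u) = f v) ∧ (∀ v, μ v = v + f v) ∧ π = φ₁ * permGate μ * φ₂ := by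
  obtain ⟨σ, rfl⟩ := hπ
  obtain ⟨S₁, S₂, c, T, f, hT, hf, hσ⟩ := h.exists_shear
  have hff : ∀ u v, f (v + f u) = f v := fun u v => hf fun i hi => by
    rw [Pi.add_apply, hT u i (by simpa using hi), add_zero]
  have hinv : Function.Involutive fun v => v + f v := fun v => by
    simp only [hff, add_assoc, add_self_bits, add_zero]
  refine ⟨permGate S₁.symm.toEquiv * permGate (Equiv.addRight c), permGate S₂.toEquiv,
    hinv.toPerm, T, f,
    ⟨(isClifford_permGate_linearEquiv _).mul (isClifford_permGate_addRight c),
      IsPermutation.mul ⟨_, rfl⟩ ⟨_, rfl⟩⟩,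
    ⟨isClifford_permGate_linearEquiv _, ⟨_, rfl⟩⟩, hT, hf, hff, fun v => rfl, ?_⟩
  rw [permGate_mul, permGate_mul, permGate_mul]
  congr 1
  ext1 v
  apply S₁.injective
  rw [hσ]
  simp

theorem mem_cliffordLevel_of_clifford_mul_mul {φ₁ φ₂ U : Gate n} (h₁ : IsClifford φ₁)
    (h₂ : IsClifford φ₂) {k : ℕ} (h : φ₁ * U * φ₂ ∈ cliffordLevel n (k + 2)) :
    U ∈ cliffordLevel n (k + 2) := by
  convert mul_clifford_mem_cliffordLevel h₂.inv (clifford_mul_mem_cliffordLevel h₁.inv h) using 1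
  group

/-- A semi-Clifford permutation of level `k + 2` is a mismatch-free circuit with at most `k + 1`
controls per gate, up to Clifford permutations: the displacement of its shear has degree at most
`k + 1`, because the shear is its own inverse. -/
theorem IsSemiClifford.exists_circuit {π : Gate n} (hπ : IsPermutation π) (h : IsSemiClifford π)
    {k : ℕ} (hk : π ∈ cliffordLevel n (k + 2)) :
    ∃ (φ₁ φ₂ : Gate n) (L : List (MCX n)),
      (IsClifford φ₁ ∧ IsPermutation φ₁) ∧ (IsClifford φ₂ ∧ IsPermutation φ₂) ∧
      MCX.MismatchFree L ∧ (∀ g ∈ L, g.controls.card ≤ k + 1) ∧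
      π = φ₁ * MCX.circuit L * φ₂ := by
  obtain ⟨φ₁, φ₂, μ, T, f, h₁, h₂, hT, hf, hff, hμ, rfl⟩ := h.exists_eq_clifford_mul_shear hπ
  have hinv : μ⁻¹ = μ := by
    refine inv_eq_of_mul_eq_one_right (Equiv.ext fun v => ?_)
    rw [Equiv.Perm.mul_apply, hμ, hμ, hff, add_assoc, add_self_bits, add_zero, Equiv.Perm.one_apply]
  have hmem := mem_cliffordLevel_of_clifford_mul_mul h₁.1 h₂.1 hk
  have df : ∀ i, DegreeLT (k + 1 + 1) fun v => f v i := by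
    intro i
    have h1 := degreeLT_of_permGate_mem hmem (LinearMap.proj i)
    have h2 : DegreeLT (k + 2) fun v : Bits n => v i :=
      (DegreeLT.of_additive fun v w => by simp).mono (by omega)
    convert h1.add h2 using 1
    ext v
    simp only [hinv, hμ, Pi.add_apply, LinearMap.proj_apply]
    linear_combination -(CharTwo.add_self_eq_zero (v i))
  obtain ⟨L, hL, hcard, hd⟩ := MCX.exists_mismatchFree_of_degreeLT hT hf df
  refine ⟨φ₁, φ₂, L, h₁, h₂, hL, hcard, ?_⟩
  obtain ⟨τ, hτ, hτd⟩ := hL.exists_circuit_eq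
  have : τ = μ := Equiv.ext fun v => by rw [hτd, hμ, hd]
  rw [hτ, this]

theorem MCX.MismatchFree.mul_circuit_mul_mem {L : List (MCX n)} (hL : MCX.MismatchFree L) {k : ℕ}
    (h : ∀ g ∈ L, g.controls.card ≤ k + 1) {φ₁ φ₂ : Gate n} (h₁ : IsClifford φ₁)
    (h₂ : IsClifford φ₂) :
    IsSemiClifford (φ₁ * MCX.circuit L * φ₂) ∧
      φ₁ * MCX.circuit L * φ₂ ∈ cliffordLevel n (k + 2) :=
  ⟨hL.isSemiClifford_circuit.clifford_mul_mul h₁ h₂,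
    mul_clifford_mem_cliffordLevel h₂
      (clifford_mul_mem_cliffordLevel h₁ (hL.circuit_mem_cliffordLevel h))⟩

/-- A semi-Clifford permutation of `n ≥ 2` qubits is in level `n`: a coordinate moved by its shear
depends on the at most `n - 1` coordinates that are not moved, so it has degree at most `n - 1`. -/
theorem IsSemiClifford.mem_cliffordLevel {m : ℕ} {π : Gate (m + 2)} (hπ : IsPermutation π)
    (h : IsSemiClifford π) : π ∈ cliffordLevel (m + 2) (m + 2) := by
  obtain ⟨φ₁, φ₂, μ, T, f, h₁, h₂, hT, hf, hff, hμ, rfl⟩ := h.exists_eq_clifford_mul_shear hπ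
  refine mul_clifford_mem_cliffordLevel h₂.1 (clifford_mul_mem_cliffordLevel h₁.1 ?_)
  have df : ∀ i, DegreeLT (m + 1 + 1) fun v => f v i := by
    intro i
    by_cases hi : i ∈ T
    · have hc : (Tᶜ : Finset (Fin (m + 2))).card + 1 ≤ m + 1 + 1 := by
        have h1 := Finset.card_compl_lt_iff_nonempty T |>.2 ⟨i, hi⟩
        rw [Fintype.card_fin] at h1
        omega
      exact (DegreeLT.of_dependsOn Tᶜ fun v w hvw => congrFun (hf hvw) i).mono hc
    · simp only [hT _ i hi]
      exact DegreeLT.zero _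
  obtain ⟨L, hL, hcard, hd⟩ := MCX.exists_mismatchFree_of_degreeLT hT hf df
  obtain ⟨τ, hτ, hτd⟩ := hL.exists_circuit_eq
  have : μ = τ := Equiv.ext fun v => by rw [hτd, hμ, hd]
  rw [this, ← hτ]
  exact hL.circuit_mem_cliffordLevel hcard

/-- Every permutation of the two labels of a single qubit is a translation. -/
theorem permGate_mem_pauliGroup_one (σ : Equiv.Perm (Bits 1)) : permGate σ ∈ pauliGroup 1 := by
  have hσ : σ = Equiv.addRight (σ 0) := by
    have hcases : ∀ v : Bits 1, v = 0 ∨ v = 1 := fun v => by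
      rcases zmod_two_cases (v 0) with h | h
      · left; ext i; rw [Subsingleton.elim i 0, h]; rfl
      · right; ext i; rw [Subsingleton.elim i 0, h]; rfl
    have h01 : (1 : Bits 1) ≠ 0 := one_ne_zero
    ext1 v
    change σ v = v + σ 0
    rcases hcases v with rfl | rfl
    · rw [zero_add]
    · have hne : σ 1 ≠ σ 0 := fun h => h01 (σ.injective h)
      rcases hcases (σ 0) with h0 | h0 <;> rcases hcases (σ 1) with h1 | h1
      · exact absurd (h1.trans h0.symm) hne
      · rw [h0, h1, add_zero]
      · rw [h0, h1, add_self_bits]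
      · exact absurd (h1.trans h0.symm) hne
  rw [hσ]
  have h := pauliXZ_mem (σ 0) 0
  rwa [pauliXZ, show ((0 : Bits 1 →ₗ[ZMod 2] ZMod 2) : Bits 1 → ZMod 2) = 0 from rfl,
    ← permGate_eq_mono] at h

end QGate

end

theorem mainTheorem8 (n : ℕ) (π : QGate.Gate n) (hπ : QGate.IsPermutation π) :
    (∀ k : ℕ, 1 ≤ k →
      ((QGate.IsSemiClifford π ∧ π ∈ QGate.cliffordLevel n (k + 1)) ↔
        ∃ (φ₁ φ₂ : QGate.Gate n) (L : List (QGate.MCX n)),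
          (QGate.IsClifford φ₁ ∧ QGate.IsPermutation φ₁) ∧
          (QGate.IsClifford φ₂ ∧ QGate.IsPermutation φ₂) ∧
          QGate.MCX.MismatchFree L ∧ (∀ g ∈ L, g.controls.card ≤ k) ∧
          π = φ₁ * QGate.MCX.circuit L * φ₂)) ∧
    ((QGate.IsSemiClifford π ∧ π ∈ QGate.cliffordLevel n 3) ↔
      ∃ (φ₁ φ₂ : QGate.Gate n) (L : List (QGate.MCX n)),
        (QGate.IsClifford φ₁ ∧ QGate.IsPermutation φ₁) ∧
        (QGate.IsClifford φ₂ ∧ QGate.IsPermutation φ₂) ∧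
        QGate.MCX.MismatchFree L ∧ (∀ g ∈ L, g.controls.card = 2) ∧
        π = φ₁ * QGate.MCX.circuit L * φ₂) ∧
    (1 ≤ n → QGate.IsSemiClifford π → π ∈ QGate.cliffordLevel n n) := by
  refine ⟨fun k hk => ?_, ⟨?_, ?_⟩, fun hn h => ?_⟩
  · obtain ⟨k, rfl⟩ := Nat.exists_eq_add_of_le' hk
    constructor
    · rintro ⟨h, hmem⟩
      exact h.exists_circuit hπ hmem
    · rintro ⟨φ₁, φ₂, L, h₁, h₂, hL, hcard, rfl⟩
      exact hL.mul_circuit_mul_mem hcard h₁.1 h₂.1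
  · rintro ⟨h, hmem⟩
    obtain ⟨φ₁, φ₂, L, h₁, h₂, hL, hcard, rfl⟩ := h.exists_circuit hπ hmem
    -- the gates with at most one control are Clifford, and commute with the Toffoli gates
    have hL' := hL.of_subset (List.filter_subset_self (p := fun g => !decide (g.controls.card = 2)) L)
    refine ⟨φ₁, QGate.MCX.circuit (L.filter fun g => !decide (g.controls.card = 2)) * φ₂,
      L.filter fun g => decide (g.controls.card = 2), h₁, ⟨?_, ?_⟩,
      hL.of_subset (List.filter_subset_self L), ?_, ?_⟩
    · refine (hL'.isClifford_circuit fun g hg => ?_).mul h₂.1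
      rw [List.mem_filter] at hg
      have h1 := hcard g hg.1
      have h2 : g.controls.card ≠ 2 := by simpa using hg.2
      omega
    · exact hL'.isPermutation_circuit.mul h₂.2
    · intro g hg
      simpa using (List.mem_filter.1 hg).2
    · rw [hL.circuit_filter fun g => decide (g.controls.card = 2)]
      simp only [mul_assoc]
  · rintro ⟨φ₁, φ₂, L, h₁, h₂, hL, hcard, rfl⟩
    exact hL.mul_circuit_mul_mem (fun g hg => (hcard g hg).le) h₁.1 h₂.1
  · match n, hn with
    | 1, _ =>
      obtain ⟨σ, rfl⟩ := hπ
      exact QGate.permGate_mem_pauliGroup_one σ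
    | m + 2, _ => exact h.mem_cliffordLevel hπ
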